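/- Let $X\subseteq\mathbb R^d$ be closed and let $\rho$ be a Borel probability measure on $X\times\mathbb R$ with $\int y^2\,d\rho<\infty$, marginal $\rho_X$ on $X$, and regression function $f_\rho(x)=\int y\,d\rho(y\mid x)$. Write $\|f\|_\rho=(\int f^2\,d\rho_X)^{1/2}$ and $\mathcal E(f)=\int (f(x)-y)^2\,d\rho(x,y)$. Let $\mu$ be a probability measure on a measurable space $V$, let $\phi:V\times X\to\mathbb R$, $\phi_v(x)=\phi(v,x)$, be measurable and square integrable with respect to $\mu\otimes\rho_X$, with $\phi(\cdot,x)\in L^2_\mu$ for every $x\in X$, and let $$K(x,x')=\int_V\phi_v(x)\phi_v(x')\,d\mu(v)\qquad (x,x'\in X).$$ Let $L_K$ be the (positive, trace class) integral operator on $L^2_{\rho_X}$ given by $(L_Kf)(u)=\int_X f(x)K(x,u)\,d\rho_X(x)$. Assume: 1. (Boundedness) $K$ is measurable and there is $\kappa\ge 1$ such that $K(x,x)\le\kappa^2$ for $\rho_X$-almost every $x$ and $\phi_v(x)\phi_v(x')\le\kappa^2$ for $\mu\otimes\rho_X\otimes\rho_X$-almost every $(v,x,x')$. 2. (Source condition)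 For some $\zeta>0$ and $R>0$, $\|L_K^{-\zeta}f_\rho\|_\rho\le R$, that is, $f_\rho=L_K^{\zeta}g$ in $L^2_{\rho_X}$ for some $g$ with $\|g\|_\rho\le R$. 3. (Effective dimension) For some $\gamma\in[0,1]$ and $c_\gamma>0$, $\operatorname{tr}\big(L_K(L_K+\lambda I)^{-1}\big)\le c_\gamma\lambda^{-\gamma}$ for all $\lambda>0$. Let $T\ge 1$ be an integer, let $(z_t,v_t)=((x_t,y_t),v_t)$, $t=1,\dots,T$, be independent with common law $\rho\otimes\mu$, and let $\eta=\eta(T)>0$ satisfy $$\eta(T)^{\gamma+1}T^{\gamma}\ln(2T)\le\frac1{4\kappa^2(c_\gamma+\kappa^2)}.$$ Define $f_1=0$ and $f_{t+1}=f_t-\eta(T)\,(f_t(x_t)-y_t)\,\phi_{v_t}(x_t)\,\phi_{v_t}$ for $t=1,\dots,T$ (the doubly stochastic algorithm without regularization and with constant step size). Then $$\mathbb E\big[\|f_{T+1}-f_\rho\|_\rho^2\big]\le C\Big((\eta(T)T)^{-2\zeta}+\eta(T)^{\gamma+1}T^{\gamma}\ln T\Big),$$ where the constant $C>0$ depends only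 on $R,\zeta,\|f_\rho\|_\rho,\mathcal E(f_\rho),\kappa^2,c_\gamma$. -/

import Mathlib

open MeasureTheory ProbabilityTheory
open scoped ENNReal

noncomputable section

namespace DoublyStochastic

/-! ### Operators on real Hilbert spaces -/

section Operators

variable {E : Type*} [NormedAddCommGroup E] [InnerProductSpace ℝ E] [CompleteSpace E]

/-- The power `L ^ s` (for `s > 0`) of a compact self-adjoint positive operator, by the spectral
theorem: `L ^ s f = ∑ σ ^ s • P_σ f`, where `P_σ` is the orthogonal projection onto the eigenspace
`ker (L - σ I)`. The sum runs over all reals `σ`; only eigenvalues contribute. -/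
def opRpow (L : E →L[ℝ] E) (s : ℝ) (f : E) : E :=
  ∑' σ : ℝ, σ ^ s • (LinearMap.ker (↑(L - σ • ContinuousLinearMap.id ℝ E) : E →ₗ[ℝ] E)).starProjection f

/-- On an eigenvector, the power of a self-adjoint operator acts as the power of the
eigenvalue. -/
theorem opRpow_of_eigenvector {L : E →L[ℝ] E} (hL : ∀ x y : E, inner ℝ (L x) y = inner ℝ x (L y))
    {σ : ℝ} {e : E} (he : L e = σ • e) (s : ℝ) : opRpow L s e = σ ^ s • e := by
  unfold opRpow
  rw [tsum_eq_single σ]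
  · congr 1
    rw [Submodule.starProjection_eq_self_iff]
    simp [he]
  · intro τ hτ
    have : (LinearMap.ker (↑(L - τ • ContinuousLinearMap.id ℝ E) : E →ₗ[ℝ] E)).starProjection e = 0 := by
      rw [Submodule.starProjection_apply_eq_zero_iff]
      intro u hu
      have hu' : L u = τ • u := by
        simpa [sub_eq_zero] using hu
      have h := hL u e
      rw [hu', he, inner_smul_left, inner_smul_right] at h
      have h2 : (τ - σ) * inner ℝ u e = 0 := by
        simp only [conj_trivial] at h
        linarith
      rcases mul_eq_zero.1 h2 with h3 | h3
      · exact absurd (sub_eq_zero.1 h3) hτ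
      · exact h3
    rw [this, smul_zero]

/-- The trace `∑ᵢ ⟪eᵢ, A eᵢ⟫ ∈ [0, ∞]` of a positive operator `A` in an orthonormal basis
(for positive operators it does not depend on the basis). -/
def posTrace (A : E →L[ℝ] E) : ℝ≥0∞ :=
  let b := (exists_hilbertBasis ℝ E).choose_spec.choose
  ∑' i, ENNReal.ofReal (inner ℝ (b i) (A (b i)))

/-- The effective dimension `tr (L (L + lam I)⁻¹)`. -/
def effectiveDimension (L : E →L[ℝ] E) (lam : ℝ) : ℝ≥0∞ :=
  posTrace (L ∘L Ring.inverse (L + lam • ContinuousLinearMap.id ℝ E))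

end Operators

/-! ### The integral operator of a kernel -/

section IntegralOperator

variable {α : Type*} [MeasurableSpace α] {ν : Measure α} [IsFiniteMeasure ν]

theorem ae_memLp_section {K : α → α → ℝ} (hK : MemLp (Function.uncurry K) 2 (ν.prod ν)) :
    ∀ᵐ u ∂ν, MemLp (fun x => K x u) 2 ν := by
  have hsm : AEStronglyMeasurable (fun p : α × α => K p.2 p.1) (ν.prod ν) :=
    hK.1.prod_swap
  have hint : Integrable (fun p : α × α => (K p.2 p.1) ^ 2) (ν.prod ν) :=
    (hK.integrable_sq).swap
  filter_upwards [hsm.prodMk_left, hint.prod_right_ae] with u h1 h2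
  exact (memLp_two_iff_integrable_sq h1).2 h2

theorem kernelIntegral_memLp {K : α → α → ℝ} (hK : MemLp (Function.uncurry K) 2 (ν.prod ν))
    (f : Lp ℝ 2 ν) :
    MemLp (fun u => ∫ x, K x u * f x ∂ν) 2 ν ∧
      eLpNorm (fun u => ∫ x, K x u * f x ∂ν) 2 ν
        ≤ eLpNorm (Function.uncurry K) 2 (ν.prod ν) * eLpNorm f 2 ν := by
  have hsm : AEStronglyMeasurable (fun p : α × α => K p.2 p.1) (ν.prod ν) :=
    hK.1.prod_swap
  have hmeas : AEStronglyMeasurable (fun u => ∫ x, K x u * f x ∂ν) ν := by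
    refine AEStronglyMeasurable.integral_prod_right' (f := fun p : α × α => K p.2 p.1 * f p.2) ?_
    exact hsm.mul (Lp.aestronglyMeasurable f).comp_snd
  have key : ∀ u, ‖∫ x, K x u * f x ∂ν‖ₑ ≤ ∫⁻ x, ‖K x u * f x‖ₑ ∂ν := fun u =>
    enorm_integral_le_lintegral_enorm _
  have hCS : ∀ᵐ u ∂ν, ‖∫ x, K x u * f x ∂ν‖ₑ ≤
      eLpNorm (fun x => K x u) 2 ν * eLpNorm f 2 ν := by
    filter_upwards [ae_memLp_section hK] with u hu
    refine (key u).trans ?_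
    rw [← eLpNorm_one_eq_lintegral_enorm]
    have := eLpNorm_smul_le_mul_eLpNorm (p := 2) (q := 2) (r := 1) (Lp.aestronglyMeasurable f) hu.1
    exact this
  have sq : ∀ {β : Type _} [MeasurableSpace β] (m : Measure β) (g : β → ℝ),
      eLpNorm g 2 m ^ (2 : ℕ) = ∫⁻ x, ‖g x‖ₑ ^ (2 : ℕ) ∂m := by
    intro β _ m g
    have h := eLpNorm_nnreal_pow_eq_lintegral (μ := m) (f := g) (p := 2) (by norm_num)
    have h2 : ((2 : NNReal) : ℝ) = ((2 : ℕ) : ℝ) := by norm_num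
    rw [h2] at h
    simpa only [ENNReal.rpow_natCast, ENNReal.coe_ofNat] using h
  have hKsq : ∫⁻ u, eLpNorm (fun x => K x u) 2 ν ^ (2 : ℕ) ∂ν
      = eLpNorm (Function.uncurry K) 2 (ν.prod ν) ^ (2 : ℕ) := by
    rw [sq (ν.prod ν), lintegral_prod_symm _ (hK.1.enorm.pow_const 2)]
    exact lintegral_congr fun u => sq ν _
  have hle : eLpNorm (fun u => ∫ x, K x u * f x ∂ν) 2 ν
        ≤ eLpNorm (Function.uncurry K) 2 (ν.prod ν) * eLpNorm f 2 ν := by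
    refine (ENNReal.pow_le_pow_left_iff two_ne_zero).1 ?_
    have hf : eLpNorm f 2 ν ≠ ∞ := (Lp.memLp f).2.ne
    calc eLpNorm (fun u => ∫ x, K x u * f x ∂ν) 2 ν ^ 2
        = ∫⁻ u, ‖∫ x, K x u * f x ∂ν‖ₑ ^ 2 ∂ν := sq ν _
      _ ≤ ∫⁻ u, eLpNorm (fun x => K x u) 2 ν ^ 2 * eLpNorm f 2 ν ^ 2 ∂ν := by
          refine lintegral_mono_ae ?_
          filter_upwards [hCS] with u hu
          rw [← mul_pow]
          exact pow_le_pow_left' hu 2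
      _ = (eLpNorm (Function.uncurry K) 2 (ν.prod ν) * eLpNorm f 2 ν) ^ 2 := by
          rw [lintegral_mul_const' _ _ (by finiteness), hKsq, mul_pow]
  refine ⟨⟨hmeas, hle.trans_lt (ENNReal.mul_lt_top hK.2 (Lp.memLp f).2)⟩, hle⟩

/-- The integral operator of a square-integrable kernel on `L²(ν)`. -/
def kernelCLM (K : α → α → ℝ) (hK : MemLp (Function.uncurry K) 2 (ν.prod ν)) :
    Lp ℝ 2 ν →L[ℝ] Lp ℝ 2 ν :=
  LinearMap.mkContinuous
    { toFun := fun f => (kernelIntegral_memLp hK f).1.toLp _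
      map_add' := by
        intro f g
        rw [← MemLp.toLp_add]
        refine MemLp.toLp_congr _ _ ?_
        filter_upwards [ae_memLp_section hK] with u hu
        simp only [Pi.add_apply]
        have hf : Integrable (fun x => K x u * f x) ν := hu.integrable_mul (Lp.memLp f)
        have hg : Integrable (fun x => K x u * g x) ν := hu.integrable_mul (Lp.memLp g)
        rw [← integral_add hf hg]
        refine integral_congr_ae ?_
        filter_upwards [Lp.coeFn_add f g] with x hx
        simp only [hx, Pi.add_apply]
        ring
      map_smul' := by
        intro c f
        rw [RingHom.id_apply, ← MemLp.toLp_const_smul]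
        refine MemLp.toLp_congr _ _ (Filter.Eventually.of_forall fun u => ?_)
        simp only [Pi.smul_apply, smul_eq_mul]
        rw [← integral_const_mul]
        refine integral_congr_ae ?_
        filter_upwards [Lp.coeFn_smul c f] with x hx
        simp only [hx, Pi.smul_apply, smul_eq_mul]
        ring }
    (eLpNorm (Function.uncurry K) 2 (ν.prod ν)).toReal (by
      intro f
      simp only [LinearMap.coe_mk, AddHom.coe_mk, Lp.norm_toLp]
      rw [Lp.norm_def, ← ENNReal.toReal_mul]
      exact ENNReal.toReal_mono (ENNReal.mul_ne_top hK.2.ne (Lp.memLp f).2.ne)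
        (kernelIntegral_memLp hK f).2)

open Classical in
/-- The integral operator `(L_K f)(u) = ∫ f(x) K(x, u) dν(x)` on `L²(ν)`, for a kernel that is
square integrable (as every bounded measurable kernel is; the other case is a dummy value). -/
def integralOperator (ν : Measure α) [IsFiniteMeasure ν] (K : α → α → ℝ) :
    Lp ℝ 2 ν →L[ℝ] Lp ℝ 2 ν :=
  if hK : MemLp (Function.uncurry K) 2 (ν.prod ν) then kernelCLM K hK else 0

theorem integralOperator_ae_eq {K : α → α → ℝ} (hK : MemLp (Function.uncurry K) 2 (ν.prod ν))
    (f : Lp ℝ 2 ν) :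
    integralOperator ν K f =ᵐ[ν] fun u => ∫ x, K x u * f x ∂ν := by
  rw [integralOperator, dif_pos hK]
  exact (kernelIntegral_memLp hK f).1.coeFn_toLp

/-- A kernel `K(x, x') = ∫ φ(v, x) φ(v, x') dμ(v)` with `K(x, x)` almost surely bounded is square
integrable, so its integral operator is the intended one. -/
theorem memLp_of_feature_representation {V : Type*} [MeasurableSpace V] {μ : Measure V}
    {φ : V → α → ℝ} {K : α → α → ℝ} {κ : ℝ}
    (hφ : ∀ x, MemLp (fun v => φ v x) 2 μ)
    (hK : ∀ x x', K x x' = ∫ v, φ v x * φ v x' ∂μ)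
    (hKm : Measurable (Function.uncurry K)) (hKb : ∀ᵐ x ∂ν, K x x ≤ κ ^ 2) :
    MemLp (Function.uncurry K) 2 (ν.prod ν) := by
  have hb : ∀ x x', |K x x'| ≤ (K x x + K x' x') / 2 := by
    intro x x'
    have h1 : Integrable (fun v => φ v x * φ v x) μ := (hφ x).integrable_mul (hφ x)
    have h2 : Integrable (fun v => φ v x' * φ v x') μ := (hφ x').integrable_mul (hφ x')
    rw [hK x x', hK x x, hK x' x', ← integral_add h1 h2, ← integral_div]
    refine (abs_integral_le_integral_abs).trans (integral_mono_of_nonneg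
      (Filter.Eventually.of_forall fun v => abs_nonneg _) ((h1.add h2).div_const 2)
      (Filter.Eventually.of_forall fun v => ?_))
    simp only
    rw [abs_le]
    constructor <;> nlinarith [sq_nonneg (φ v x - φ v x'), sq_nonneg (φ v x + φ v x')]
  refine MemLp.of_bound hKm.aestronglyMeasurable (κ ^ 2) ?_
  have h1 := (Measure.quasiMeasurePreserving_fst (μ := ν) (ν := ν)).ae hKb
  have h2 := (Measure.quasiMeasurePreserving_snd (μ := ν) (ν := ν)).ae hKb
  filter_upwards [h1, h2] with p hp1 hp2
  have := hb p.1 p.2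
  simp only [Function.uncurry, Real.norm_eq_abs]
  linarith

end IntegralOperator

/-! ### The learning problem and the algorithm -/

section Learning

variable {X V : Type*} [MeasurableSpace X]

/-- The regression function `f_ρ(x) = ∫ y dρ(y | x)`. -/
def regressionFunction (ρ : Measure (X × ℝ)) [IsFiniteMeasure ρ] (x : X) : ℝ :=
  ∫ y, y ∂(ρ.condKernel x)

/-- The expected risk `∫ (f(x) - y)² dρ(x, y)`. -/
def expectedRisk (ρ : Measure (X × ℝ)) (f : X → ℝ) : ℝ :=
  ∫ p, (f p.1 - p.2) ^ 2 ∂ρ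

/-- The doubly stochastic iterates `f_t` with features `φ`, step sizes `η`, regularization `lam`,
samples `z t = (x_t, y_t)` and random features `v t`: `f_1 = 0` and
`f_{t+1} = (1 - η_t lam) f_t - η_t (f_t(x_t) - y_t) φ_{v_t}(x_t) φ_{v_t}` for `t ≥ 1`
(the value at the index `0` is not used). -/
def iterate (φ : V → X → ℝ) (η : ℕ → ℝ) (lam : ℝ) (z : ℕ → X × ℝ) (v : ℕ → V) : ℕ → X → ℝ
  | 0 => 0
  | 1 => 0
  | t + 2 => fun x =>
      (1 - η (t + 1) * lam) * iterate φ η lam z v (t + 1) x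
        - η (t + 1) * (iterate φ η lam z v (t + 1) (z (t + 1)).1 - (z (t + 1)).2)
          * φ (v (t + 1)) (z (t + 1)).1 * φ (v (t + 1)) x

end Learning

end DoublyStochastic

end

set_option linter.unusedSectionVars false

noncomputable section

namespace DoublyStochastic

/-! Work in `L²(ρ_X)` with the error `e_n` after `n` steps. Fubini gives `L_K = E[φ_v ⊗ φ_v]`, and
the regression residual `f_ρ(x) - y` is orthogonal to functions of `x`. Hence a step sends `e` to
`(1 - ηL)e` on average, and its second moment is controlled by `E(f(x) - y)² = ‖e‖² + ℰ(f_ρ)`.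

A bound on `E‖e_n‖²` alone does not close with the right rate, so the proof follows the two-index
family `u n k = E‖(1 - ηL)^k e_n‖²` (`dampedError`). One step (`lintegral_step_le`,
`dampedError_succ_le`) costs `u (n+1) k ≤ u n (k+1) + q_k (u n 0 + ℰ(f_ρ))`, where `q_k = η²κ² E‖(1
- ηL)^k φ_v‖²`. Unrolled, this bounds `u T 0` by a bias term `u 0 T` plus a variance term `∑ q_j (u
(T-1-j) 0 + ℰ(f_ρ))`.

Bias: on an eigenvector with eigenvalue `σ` the source condition leaves `(1 - ησ)^T σ^ζ ≤
(ζ/(ηT))^ζ` (`norm_pow_opRpow_le`).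

Variance: by Parseval, `E‖(1 - ηL)^k φ_v‖²` is the trace of `(1 - ηL)^k L (1 - ηL)^k`, and this
operator is at most `(λ + 1/(2ηk)) L(L + λ)⁻¹`. Taking `λ = 1/(ηk)` and using the effective
dimension gives `2 c_γ (ηk)^(γ-1)`; summing over `k` gives `∑ q_k ≲ η^(γ+1) T^γ ln(2T)`
(`sum_variance_le`).

The step-size condition makes `∑ q_k ≤ 1/2`, so induction first shows that the errors stay bounded
(`le_of_recursion`); feeding this bound back into the variance term yields the rate. -/

/-- Bound on a weighted sum of projections onto pairwise orthogonal subspaces. -/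
theorem norm_sum_smul_starProjection_le {E : Type*} [NormedAddCommGroup E]
    [InnerProductSpace ℝ E] {ι : Type*} {U : ι → Submodule ℝ E}
    [∀ i, (U i).HasOrthogonalProjection]
    (hU : ∀ i j, i ≠ j → ∀ x ∈ U i, ∀ y ∈ U j, inner ℝ x y = (0 : ℝ)) {c : ι → ℝ} {B : ℝ}
    (hB : 0 ≤ B) (g : E) (hc : ∀ i, (U i).starProjection g ≠ 0 → |c i| ≤ B) (s : Finset ι) :
    ‖∑ i ∈ s, c i • (U i).starProjection g‖ ≤ B * ‖g‖ := by
  have pyth : ∀ c : ι → ℝ, ‖∑ i ∈ s, c i • (U i).starProjection g‖ ^ 2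
      = ∑ i ∈ s, c i ^ 2 * ‖(U i).starProjection g‖ ^ 2 := by
    intro c
    rw [← real_inner_self_eq_norm_sq, sum_inner]
    refine Finset.sum_congr rfl fun i hi => ?_
    rw [inner_sum, Finset.sum_eq_single i]
    · rw [inner_smul_left, inner_smul_right, real_inner_self_eq_norm_sq]
      simp only [conj_trivial]; ring
    · intro j _ hj
      rw [inner_smul_left, inner_smul_right,
        hU i j hj.symm _ (Submodule.starProjection_apply_mem _ _) _
          (Submodule.starProjection_apply_mem _ _)]
      simp
    · intro h; exact absurd hi h
  -- Bessel: for `h = ∑ P_i g` both `‖h‖²` and `⟪h, g⟫` equal the sum, so Cauchy-Schwarz gives `‖h‖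
  -- ≤ ‖g‖`.
  have bessel : ∑ i ∈ s, ‖(U i).starProjection g‖ ^ 2 ≤ ‖g‖ ^ 2 := by
    set h := ∑ i ∈ s, (1 : ℝ) • (U i).starProjection g with hh
    have e1 : ‖h‖ ^ 2 = ∑ i ∈ s, ‖(U i).starProjection g‖ ^ 2 := by
      rw [hh, pyth]; simp
    have e2 : inner ℝ h g = ∑ i ∈ s, ‖(U i).starProjection g‖ ^ 2 := by
      rw [hh, sum_inner]
      refine Finset.sum_congr rfl fun i _ => ?_
      rw [one_smul, ← real_inner_self_eq_norm_sq,
        ← Submodule.inner_starProjection_left_eq_right,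
        Submodule.starProjection_eq_self_iff.2 (Submodule.starProjection_apply_mem _ _)]
    have e3 := real_inner_le_norm h g
    rw [← e1] at e2 ⊢
    rw [e2] at e3
    have : ‖h‖ ≤ ‖g‖ := by
      rcases eq_or_lt_of_le (norm_nonneg h) with h0 | h0
      · rw [← h0]; exact norm_nonneg g
      · nlinarith
    gcongr
  refine le_of_sq_le_sq ?_ (by positivity)
  rw [pyth, mul_pow]
  calc ∑ i ∈ s, c i ^ 2 * ‖(U i).starProjection g‖ ^ 2
      ≤ ∑ i ∈ s, B ^ 2 * ‖(U i).starProjection g‖ ^ 2 := by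
        refine Finset.sum_le_sum fun i _ => ?_
        by_cases h : (U i).starProjection g = 0
        · simp [h]
        · have := sq_le_sq' (by linarith [hc i h, abs_nonneg (c i)]) (hc i h)
          rw [sq_abs] at this
          gcongr
    _ ≤ B ^ 2 * ‖g‖ ^ 2 := by rw [← Finset.mul_sum]; gcongr

/-! ### Operator inequalities for polynomials in a positive contraction -/

section PositiveOperators

variable {E : Type*} [NormedAddCommGroup E] [InnerProductSpace ℝ E] [CompleteSpace E]

open ContinuousLinearMap in
theorem isPositive_mul_mul_self {S W : E →L[ℝ] E} (hS : S.IsPositive) (hW : IsSelfAdjoint W)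
    (hc : Commute W S) : (S * (W * W)).IsPositive := by
  have h := hS.conj_adjoint W
  rw [← star_eq_adjoint, hW.star_eq] at h
  have e : S * (W * W) = W ∘L S ∘L W := by
    change _ = W * (S * W)
    rw [← mul_assoc, ← mul_assoc, hc.eq]
  rwa [e]

/-- Even powers form the square of a self-adjoint `W` commuting with `u`, and `S W² = W S W` is
positive for `S` any of `1`, `u`, `1 - u`. If both exponents are odd, `u(1-u) = u(1-u)² + (1-u)u²`
reduces to those cases. -/
theorem isPositive_pow_mul_one_sub_pow {u : E →L[ℝ] E} (h0 : u.IsPositive)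
    (h1 : (1 - u).IsPositive) (a b : ℕ) : (u ^ a * (1 - u) ^ b).IsPositive := by
  have su : IsSelfAdjoint u := h0.isSelfAdjoint
  have sv : IsSelfAdjoint (1 - u) := h1.isSelfAdjoint
  have c : Commute u (1 - u) := (Commute.one_right u).sub_right (Commute.refl u)
  have sw : ∀ a b : ℕ, IsSelfAdjoint (u ^ a * (1 - u) ^ b) := fun a b =>
    ((su.pow a).commute_iff (sv.pow b)).1 (c.pow_pow a b)
  have cu : ∀ a b : ℕ, Commute (u ^ a * (1 - u) ^ b) u := fun a b =>
    (Commute.pow_self u a).mul_left (c.symm.pow_left b)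
  have cv : ∀ a b : ℕ, Commute (u ^ a * (1 - u) ^ b) (1 - u) := fun a b =>
    (c.pow_left a).mul_left (Commute.pow_self _ b)
  have sq : ∀ a b : ℕ, (u ^ a * (1 - u) ^ b) * (u ^ a * (1 - u) ^ b)
      = u ^ (2 * a) * (1 - u) ^ (2 * b) := fun a b => by
    rw [two_mul, two_mul, pow_add, pow_add, (c.symm.pow_pow b a).mul_mul_mul_comm]
  have p1 : (1 : E →L[ℝ] E).IsPositive := ContinuousLinearMap.isPositive_one
  obtain ⟨a', rfl | rfl⟩ := a.even_or_odd' <;> obtain ⟨b', rfl | rfl⟩ := b.even_or_odd'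
  · have := isPositive_mul_mul_self p1 (sw a' b') (Commute.one_right _)
    rwa [sq, one_mul] at this
  · have := isPositive_mul_mul_self h1 (sw a' b') (cv a' b')
    rw [sq] at this
    convert this using 1
    rw [pow_succ', ← mul_assoc, ← mul_assoc, (c.pow_left _).eq]
  · have := isPositive_mul_mul_self h0 (sw a' b') (cu a' b')
    rw [sq] at this
    convert this using 1
    rw [pow_succ', mul_assoc]
  · have h2 := isPositive_mul_mul_self h0 (sw a' (b' + 1)) (cu _ _)
    have h3 := isPositive_mul_mul_self h1 (sw (a' + 1) b') (cv _ _)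
    have h4 := h2.add h3
    rw [sq, sq] at h4
    convert h4 using 1
    have e3 : (1 - u) * (u ^ (2 * (a' + 1)) * (1 - u) ^ (2 * b'))
        = u ^ (2 * a' + 1) * (u * (1 - u) ^ (2 * b' + 1)) := by
      rw [pow_succ' (1 - u), ← mul_assoc, ← (c.pow_left _).eq, ← mul_assoc, ← mul_assoc,
        ← pow_succ, mul_assoc, mul_assoc]
      rfl
    have e2 : u * (u ^ (2 * a') * (1 - u) ^ (2 * (b' + 1)))
        = u ^ (2 * a' + 1) * ((1 - u) * (1 - u) ^ (2 * b' + 1)) := by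
      rw [← mul_assoc, ← pow_succ', ← pow_succ']
      ring_nf
    rw [e3, e2, ← mul_add, ← add_mul, sub_add_cancel, one_mul]

open Polynomial in
/-- The real polynomials that are sums of products of `X`, `1 - X` and nonnegative constants. -/
def bernsteinCone : Subsemiring ℝ[X] :=
  Subsemiring.closure ({X, 1 - X} ∪ {p | ∃ c : ℝ, 0 ≤ c ∧ p = C c})

open Polynomial in
theorem X_mem_bernsteinCone : (X : ℝ[X]) ∈ bernsteinCone :=
  Subsemiring.subset_closure (by simp)

open Polynomial in
theorem one_sub_X_mem_bernsteinCone : (1 - X : ℝ[X]) ∈ bernsteinCone :=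
  Subsemiring.subset_closure (by simp)

open Polynomial in
theorem C_mem_bernsteinCone {c : ℝ} (hc : 0 ≤ c) : (C c : ℝ[X]) ∈ bernsteinCone :=
  Subsemiring.subset_closure (Or.inr ⟨c, hc, rfl⟩)

open Polynomial in
-- This replaces the functional calculus: a scalar inequality on `[0, 1]` passes to operators once
-- the difference of its sides is written as a member of the cone.
theorem isPositive_aeval_of_mem_bernsteinCone {u : E →L[ℝ] E} (h0 : u.IsPositive)
    (h1 : (1 - u).IsPositive) {p : ℝ[X]} (hp : p ∈ bernsteinCone) : (aeval u p).IsPositive := by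
  rw [bernsteinCone, Subsemiring.mem_closure_iff] at hp
  induction hp using AddSubmonoid.closure_induction with
  | zero => simp
  | add p q _ _ hp hq => rw [map_add]; exact hp.add hq
  | mem p hp =>
    obtain ⟨c, hc, a, b, rfl⟩ : ∃ c : ℝ, 0 ≤ c ∧ ∃ a b : ℕ, p = C c * (X ^ a * (1 - X) ^ b) := by
      induction hp using Submonoid.closure_induction with
      | one => exact ⟨1, zero_le_one, 0, 0, by simp⟩
      | mul p q _ _ hp hq =>
        obtain ⟨c, hc, a, b, rfl⟩ := hp
        obtain ⟨c', hc', a', b', rfl⟩ := hq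
        exact ⟨c * c', mul_nonneg hc hc', a + a', b + b', by rw [C_mul]; ring⟩
      | mem p hp =>
        rcases hp with (rfl | rfl) | ⟨c, hc, rfl⟩
        · exact ⟨1, zero_le_one, 1, 0, by simp⟩
        · exact ⟨1, zero_le_one, 0, 1, by simp⟩
        · exact ⟨c, hc, 0, 0, by simp⟩
    have h := (isPositive_pow_mul_one_sub_pow h0 h1 a b).smul_of_nonneg hc
    simpa [Algebra.algebraMap_eq_smul_one] using h

open Polynomial in
theorem one_sub_pow_mem_bernsteinCone (n : ℕ) : (1 - (1 - X) ^ n : ℝ[X]) ∈ bernsteinCone := by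
  induction n with
  | zero => simp
  | succ n ih =>
    have e : (1 - (1 - X) ^ (n + 1) : ℝ[X]) = (1 - (1 - X) ^ n) + (1 - X) ^ n * X := by ring
    rw [e]
    exact add_mem ih (mul_mem (pow_mem one_sub_X_mem_bernsteinCone n) X_mem_bernsteinCone)

open Polynomial in
-- The induction needs the stronger `n X (1-X)^n ≤ 1 - (1-X)^n`, whose gap grows by `(n+1) X²
-- (1-X)^n` at each step.
theorem one_sub_mul_pow_mem_bernsteinCone (n : ℕ) :
    (1 - (n : ℝ[X]) * X * (1 - X) ^ n) ∈ bernsteinCone := by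
  have h : ∀ n : ℕ, (1 - (1 - X) ^ n - (n : ℝ[X]) * X * (1 - X) ^ n) ∈ bernsteinCone := by
    intro n
    induction n with
    | zero => simp
    | succ n ih =>
      have e : (1 - (1 - X) ^ (n + 1) - ((n + 1 : ℕ) : ℝ[X]) * X * (1 - X) ^ (n + 1) : ℝ[X])
          = (1 - (1 - X) ^ n - (n : ℝ[X]) * X * (1 - X) ^ n)
            + ((n + 1 : ℕ) : ℝ[X]) * (X * X * (1 - X) ^ n) := by
        push_cast; ring
      rw [e]
      exact add_mem ih (mul_mem (natCast_mem _ _) (mul_mem (mul_mem X_mem_bernsteinCone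
        X_mem_bernsteinCone) (pow_mem one_sub_X_mem_bernsteinCone n)))
  have e : (1 - (n : ℝ[X]) * X * (1 - X) ^ n)
      = (1 - (1 - X) ^ n - (n : ℝ[X]) * X * (1 - X) ^ n) + (1 - X) ^ n := by ring
  rw [e]
  exact add_mem (h n) (pow_mem one_sub_X_mem_bernsteinCone n)

open Polynomial in
-- A denominator-free form of `u(1-u)^n ≤ (l + 1/n) u/(u+l)`. After cancelling, it says `(1-u)^n
-- (u+l) ≤ l + 1/n`, the sum of `l(1-u)^n ≤ l` and `u(1-u)^n ≤ 1/n`.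
theorem isPositive_damped {u : E →L[ℝ] E} (h0 : u.IsPositive)
    (h1 : (1 - u).IsPositive) {n : ℕ} (hn : n ≠ 0) {l : ℝ} (hl : 0 ≤ l) :
    ((l + 1 / n) • (u * (u + l • 1)) - u * (1 - u) ^ n * ((u + l • 1) * (u + l • 1))).IsPositive := by
  have hn' : (n : ℝ) ≠ 0 := Nat.cast_ne_zero.2 hn
  have hp : (X * (X + C l) * (C l * (1 - (1 - X) ^ n)
      + C (1 / n : ℝ) * (1 - (n : ℝ[X]) * X * (1 - X) ^ n))) ∈ bernsteinCone :=
    mul_mem (mul_mem X_mem_bernsteinCone (add_mem X_mem_bernsteinCone (C_mem_bernsteinCone hl)))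
      (add_mem (mul_mem (C_mem_bernsteinCone hl) (one_sub_pow_mem_bernsteinCone n))
        (mul_mem (C_mem_bernsteinCone (by positivity)) (one_sub_mul_pow_mem_bernsteinCone n)))
  have e : (X * (X + C l) * (C l * (1 - (1 - X) ^ n)
      + C (1 / n : ℝ) * (1 - (n : ℝ[X]) * X * (1 - X) ^ n)))
      = C (l + 1 / n) * (X * (X + C l)) - X * (1 - X) ^ n * ((X + C l) * (X + C l)) := by
    have : C (1 / n : ℝ) * (n : ℝ[X]) = 1 := by
      rw [← C_eq_natCast, ← C_mul]; simp [hn']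
    rw [C_add]
    linear_combination (-(X * (X + C l) * X * (1 - X) ^ n)) * this
  rw [e] at hp
  have := isPositive_aeval_of_mem_bernsteinCone h0 h1 hp
  simpa [Algebra.algebraMap_eq_smul_one, ← add_smul] using this

theorem isUnit_add_smul_id {L : E →L[ℝ] E} (hL : L.IsPositive) {lam : ℝ} (hlam : 0 < lam) :
    IsUnit (L + lam • ContinuousLinearMap.id ℝ E) := by
  refine ContinuousLinearMap.isUnit_of_forall_le_norm_inner_map _ (c := ⟨lam, hlam.le⟩) hlam ?_
  intro x
  have h := hL.inner_nonneg_left x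
  have e : inner ℝ ((L + lam • ContinuousLinearMap.id ℝ E) x) x
      = inner ℝ (L x) x + ‖x‖ ^ 2 * lam := by
    simp [inner_add_left, inner_smul_left, mul_comm]
  rw [e]
  exact (le_add_of_nonneg_left h).trans (Real.le_norm_self _)

/-- Substituting `b = (L + lam) h` removes the inverse; the claim becomes the previous polynomial
inequality at `u = ηL`, `l = η lam`, with exponent `2k` because the damping occurs on both sides of
`L`. -/
theorem inner_damped_le {L : E →L[ℝ] E} (hL : L.IsPositive) {η : ℝ} (hη : 0 < η)
    (h1 : (1 - η • L).IsPositive) {k : ℕ} (hk : k ≠ 0) {lam : ℝ} (hlam : 0 < lam) (b : E) :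
    inner ℝ (L (((1 - η • L) ^ k) b)) (((1 - η • L) ^ k) b) ≤ (lam + 1 / (2 * η * k)) *
      inner ℝ b ((L ∘L Ring.inverse (L + lam • ContinuousLinearMap.id ℝ E)) b) := by
  set u : E →L[ℝ] E := η • L with hu
  have h0 : u.IsPositive := hL.smul_of_nonneg hη.le
  have hun := isUnit_add_smul_id hL hlam
  obtain ⟨h, hh, hbh⟩ : ∃ h : E, (L ∘L Ring.inverse (L + lam • ContinuousLinearMap.id ℝ E)) b = L h
      ∧ b = L h + lam • h := by
    refine ⟨Ring.inverse (L + lam • ContinuousLinearMap.id ℝ E) b, rfl, ?_⟩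
    have := DFunLike.congr_fun (Ring.mul_inverse_cancel _ hun) b
    simpa using this.symm
  rw [hh]
  have key := (isPositive_damped h0 h1 (n := 2 * k) (by positivity) (l := η * lam)
    (by positivity)).inner_nonneg_left h
  have c : Commute u (1 - u) := (Commute.one_right u).sub_right (Commute.refl u)
  have cl : Commute (u + (η * lam) • 1) (u * (1 - u) ^ (2 * k)) := by
    refine Commute.mul_right ?_ ?_
    · exact (Commute.refl u).add_left ((Commute.one_left u).smul_left _)
    · exact (c.pow_right _).add_left ((Commute.one_left _).smul_left _)
  have hb : (u + (η * lam) • (1 : E →L[ℝ] E)) h = η • b := by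
    rw [hbh]; simp [hu, smul_add, smul_smul]
  have sul : ((u + (η * lam) • (1 : E →L[ℝ] E)) : E →L[ℝ] E).IsPositive :=
    h0.add (ContinuousLinearMap.isPositive_one.smul_of_nonneg (by positivity))
  have sP : ((1 - u) ^ k : E →L[ℝ] E).IsPositive := by
    simpa using isPositive_pow_mul_one_sub_pow h0 h1 0 k
  have e1 : inner ℝ ((u * (u + (η * lam) • 1)) h) h = η ^ 2 * inner ℝ b (L h) := by
    have : u * (u + (η * lam) • 1) = (u + (η * lam) • 1) * u :=
      ((Commute.refl u).add_right ((Commute.one_right u).smul_right _)).eq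
    rw [this, mul_apply_eq_comp, sul.isSymmetric.apply_clm, hb]
    simp [hu, inner_smul_left, inner_smul_right, real_inner_comm]
    ring
  have e2 : inner ℝ ((u * (1 - u) ^ (2 * k) * ((u + (η * lam) • 1) * (u + (η * lam) • 1))) h) h
      = η ^ 3 * inner ℝ (L (((1 - u) ^ k) b)) (((1 - u) ^ k) b) := by
    rw [← mul_assoc, ← cl.eq, mul_assoc, mul_apply_eq_comp, sul.isSymmetric.apply_clm,
      mul_apply_eq_comp, hb, two_mul, pow_add, ← mul_assoc, (c.pow_right k).eq,
      mul_assoc, mul_apply_eq_comp, sP.isSymmetric.apply_clm]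
    simp [hu, inner_smul_left, inner_smul_right]
    ring
  rw [sub_apply, inner_sub_left, smul_apply,
    inner_smul_left, e1, e2] at key
  simp only [conj_trivial] at key
  have hk' : (k : ℝ) ≠ 0 := Nat.cast_ne_zero.2 hk
  have e3 : (η * lam + 1 / ((2 * k : ℕ) : ℝ)) * (η ^ 2 * inner ℝ b (L h))
      = η ^ 3 * ((lam + 1 / (2 * η * k)) * inner ℝ b (L h)) := by
    push_cast; field_simp
  rw [e3, ← mul_sub] at key
  have := nonneg_of_mul_nonneg_right key (by positivity)
  linarith

theorem tsum_inner_damped_le {L : E →L[ℝ] E} (hL : L.IsPositive) {η : ℝ} (hη : 0 < η)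
    (h1 : (1 - η • L).IsPositive) {k : ℕ} (hk : k ≠ 0) {lam : ℝ} (hlam : 0 < lam) :
    ∑' i, ENNReal.ofReal (inner ℝ
        (L (((1 - η • L) ^ k) ((exists_hilbertBasis ℝ E).choose_spec.choose i)))
        (((1 - η • L) ^ k) ((exists_hilbertBasis ℝ E).choose_spec.choose i)))
      ≤ ENNReal.ofReal (lam + 1 / (2 * η * k)) * effectiveDimension L lam := by
  unfold effectiveDimension posTrace
  rw [← ENNReal.tsum_mul_left]
  refine ENNReal.tsum_le_tsum fun i => ?_
  rw [← ENNReal.ofReal_mul (by positivity)]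
  exact ENNReal.ofReal_le_ofReal (inner_damped_le hL hη h1 hk hlam _)

/-- Combine `1 - u ≤ e^(-u)` with `x ≤ e^x` at `x = uT/ζ`, raised to the power `ζ`. -/
theorem one_sub_pow_mul_rpow_le {u ζ : ℝ} (hu0 : 0 ≤ u) (hu1 : u ≤ 1) (hζ : 0 < ζ) {T : ℕ}
    (hT : T ≠ 0) : (1 - u) ^ T * u ^ ζ ≤ (ζ / T) ^ ζ := by
  have hT' : (0 : ℝ) < T := by positivity
  have h1 : (1 - u) ^ T ≤ Real.exp (-(u * T)) := by
    calc (1 - u) ^ T ≤ Real.exp (-u) ^ T :=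
          pow_le_pow_left₀ (by linarith) (by linarith [Real.add_one_le_exp (-u)]) T
      _ = Real.exp (-(u * T)) := by rw [← Real.exp_nat_mul]; ring_nf
  have h2 : u ^ ζ ≤ (ζ / T) ^ ζ * Real.exp (u * T) := by
    have h3 : u ≤ ζ / T * Real.exp (u * T / ζ) := by
      have := Real.add_one_le_exp (u * T / ζ)
      calc u = ζ / T * (u * T / ζ) := by field_simp
        _ ≤ _ := by gcongr; linarith
    calc u ^ ζ ≤ (ζ / T * Real.exp (u * T / ζ)) ^ ζ := by gcongr
      _ = _ := by
        rw [Real.mul_rpow (by positivity) (by positivity), ← Real.exp_mul]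
        congr 2; field_simp
  calc (1 - u) ^ T * u ^ ζ ≤ Real.exp (-(u * T)) * ((ζ / T) ^ ζ * Real.exp (u * T)) := by
        gcongr
    _ = (ζ / T) ^ ζ * (Real.exp (-(u * T)) * Real.exp (u * T)) := by ring
    _ = _ := by rw [← Real.exp_add]; simp

theorem norm_one_sub_pow_apply_le {u : E →L[ℝ] E} (h0 : u.IsPositive)
    (h1 : (1 - u).IsPositive) (k : ℕ) (x : E) : ‖((1 - u) ^ k) x‖ ≤ ‖x‖ := by
  have hp := isPositive_aeval_of_mem_bernsteinCone h0 h1 (one_sub_pow_mem_bernsteinCone (2 * k))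
  have hk : ((1 - u) ^ k).IsPositive := by
    simpa using isPositive_pow_mul_one_sub_pow h0 h1 0 k
  have e : Polynomial.aeval u (1 - (1 - Polynomial.X : Polynomial ℝ) ^ (2 * k))
      = 1 - (1 - u) ^ k * (1 - u) ^ k := by simp [two_mul, pow_add]
  rw [e] at hp
  have h := hp.inner_nonneg_left x
  simp only [sub_apply, inner_sub_left, mul_apply_eq_comp, one_apply_eq_self] at h
  rw [hk.isSymmetric.apply_clm, real_inner_self_eq_norm_sq, real_inner_self_eq_norm_sq] at h
  exact le_of_sq_le_sq (by linarith) (norm_nonneg x)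

/-- The operator acts on each eigenspace by a scalar, so finite partial sums of the spectral series
obey the scalar bound by orthogonality, and the limit inherits it. Compactness of `L` plays no role.
-/
theorem norm_pow_opRpow_le {L : E →L[ℝ] E} (hL : L.IsPositive) {η : ℝ} (hη : 0 < η)
    (h1 : (1 - η • L).IsPositive) {ζ : ℝ} (hζ : 0 < ζ) {T : ℕ} (hT : T ≠ 0) (g : E) :
    ‖((1 - η • L) ^ T) (opRpow L ζ g)‖ ≤ (ζ / (η * T)) ^ ζ * ‖g‖ := by
  set U : ℝ → Submodule ℝ E := fun σ =>
    LinearMap.ker (↑(L - σ • ContinuousLinearMap.id ℝ E) : E →ₗ[ℝ] E) with hU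
  have memU : ∀ σ x, x ∈ U σ ↔ L x = σ • x := fun σ x => by simp [hU, sub_eq_zero]
  have hT' : (0 : ℝ) < T := by positivity
  have orth : ∀ i j, i ≠ j → ∀ x ∈ U i, ∀ y ∈ U j, inner ℝ x y = (0 : ℝ) := by
    intro i j hij x hx y hy
    rw [memU] at hx hy
    have h : inner ℝ (L x) y = inner ℝ x (L y) := hL.isSymmetric x y
    rw [hx, hy, inner_smul_left, inner_smul_right] at h
    simp only [conj_trivial] at h
    have : (i - j) * inner ℝ x y = 0 := by linarith
    exact (mul_eq_zero.1 this).resolve_left (sub_ne_zero.2 hij)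
  have spec : ∀ σ x, x ∈ U σ → x ≠ 0 → 0 ≤ η * σ ∧ η * σ ≤ 1 := by
    intro σ x hx h0
    rw [memU] at hx
    have p0 := hL.inner_nonneg_left x
    have p1 := h1.inner_nonneg_left x
    have hpos : 0 < ‖x‖ ^ 2 := by positivity
    simp only [sub_apply, one_apply_eq_self, smul_apply, inner_sub_left,
      inner_smul_left, hx, real_inner_self_eq_norm_sq, conj_trivial] at p0 p1
    have q0 : 0 ≤ σ := nonneg_of_mul_nonneg_left p0 hpos
    refine ⟨by positivity, ?_⟩
    have : 0 ≤ (1 - η * σ) * ‖x‖ ^ 2 := by linarith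
    linarith [nonneg_of_mul_nonneg_left this hpos]
  have powU : ∀ σ x, x ∈ U σ → ∀ n : ℕ, ((1 - η • L) ^ n) x = (1 - η * σ) ^ n • x := by
    intro σ x hx n
    rw [memU] at hx
    induction n with
    | zero => simp
    | succ n ih =>
      rw [pow_succ', mul_apply_eq_comp, ih, map_smul]
      simp only [sub_apply, one_apply_eq_self, smul_apply, hx]
      rw [pow_succ, mul_smul, sub_smul, one_smul, smul_smul]
  -- A divergent series would make `opRpow` the default value zero, for which the bound is trivial.
  by_cases hs : Summable fun σ : ℝ => σ ^ ζ • (U σ).starProjection g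
  · have hs2 := hs.hasSum.mapL ((1 - η • L) ^ T)
    refine le_of_tendsto (hs2.norm) (Filter.Eventually.of_forall fun s => ?_)
    have e : ∀ σ, ((1 - η • L) ^ T) (σ ^ ζ • (U σ).starProjection g)
        = (σ ^ ζ * (1 - η * σ) ^ T) • (U σ).starProjection g := fun σ => by
      rw [map_smul, powU σ _ (Submodule.starProjection_apply_mem _ _), smul_smul]
    simp only [e]
    refine norm_sum_smul_starProjection_le orth (by positivity) g (fun σ hσ => ?_) s
    obtain ⟨q0, q1⟩ := spec σ _ (Submodule.starProjection_apply_mem _ _) hσ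
    have s0 : 0 ≤ σ := nonneg_of_mul_nonneg_right q0 hη
    have q2 : 0 ≤ (1 - η * σ) ^ T := pow_nonneg (by linarith) T
    rw [abs_of_nonneg (by positivity)]
    have b := one_sub_pow_mul_rpow_le q0 q1 hζ hT
    rw [Real.mul_rpow hη.le s0] at b
    have e2 : (ζ / (η * T)) ^ ζ = (ζ / T) ^ ζ / η ^ ζ := by
      rw [← Real.div_rpow (by positivity) hη.le]; congr 1; field_simp
    rw [e2, le_div_iff₀ (by positivity)]
    linarith
  · rw [opRpow, tsum_eq_zero_of_not_summable hs, map_zero, norm_zero]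
    positivity

end PositiveOperators

/-! ### Countable bases and measurability in separable Hilbert spaces -/

section Separable

variable {H : Type*} [NormedAddCommGroup H] [InnerProductSpace ℝ H]

/-- Orthonormal vectors lie at distance `√2`, so the balls of radius `1/2` around them are disjoint.
-/
theorem countable_of_orthonormal [SecondCountableTopology H] {ι : Type*} {b : ι → H}
    (hb : Orthonormal ℝ b) : Countable ι := by
  refine Pairwise.countable_of_isOpen_disjoint (s := fun i => Metric.ball (b i) (1 / 2)) ?_
    (fun _ => Metric.isOpen_ball) (fun i => ⟨b i, Metric.mem_ball_self (by norm_num)⟩)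
  intro i j hij
  refine Metric.ball_disjoint_ball ?_
  have h : ‖b i - b j‖ ^ 2 = 2 := by
    rw [norm_sub_sq_real, hb.1 i, hb.1 j, hb.2 hij]; norm_num
  rw [dist_eq_norm]
  nlinarith [norm_nonneg (b i - b j)]

/-- Weak measurability implies strong measurability in a separable Hilbert space. -/
theorem stronglyMeasurable_of_inner [CompleteSpace H] [SecondCountableTopology H] {α : Type*}
    [MeasurableSpace α] {g : α → H} (hg : ∀ y : H, Measurable fun a => inner ℝ y (g a)) :
    StronglyMeasurable g := by
  obtain ⟨w, b, -⟩ := exists_hilbertBasis ℝ H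
  have : Countable w := countable_of_orthonormal b.orthonormal
  refine stronglyMeasurable_of_tendsto (u := Filter.atTop)
    (f := fun (s : Finset w) a => ∑ i ∈ s, inner ℝ (b i) (g a) • b i) (fun s => ?_) ?_
  · exact Finset.stronglyMeasurable_fun_sum s fun i _ =>
      (hg (b i)).stronglyMeasurable.smul_const (b i)
  · rw [tendsto_pi_nhds]
    intro a
    have h := b.hasSum_repr (g a)
    simp only [HilbertBasis.repr_apply_apply] at h
    exact h

end Separable

/-! ### Random features and the second-moment form of the integral operator -/

section Features

variable {α V : Type*} [MeasurableSpace α] [MeasurableSpace V] {ν : Measure α}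
  [IsProbabilityMeasure ν] {μ : Measure V} [IsProbabilityMeasure μ] {φ : V → α → ℝ} {κ : ℝ}

/-- On the square of `{φ_v > κ}`, and likewise of `{φ_v < -κ}`, the product exceeds `κ²`; a set
whose square is null is itself null. -/
theorem ae_abs_le_of_ae_mul_le (hκ : 0 ≤ κ)
    (h : ∀ᵐ p ∂(μ.prod (ν.prod ν)), φ p.1 p.2.1 * φ p.1 p.2.2 ≤ κ ^ 2) :
    ∀ᵐ v ∂μ, ∀ᵐ x ∂ν, |φ v x| ≤ κ := by
  filter_upwards [Measure.ae_ae_of_ae_prod h] with v hv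
  have key : ∀ S : Set α, (∀ x ∈ S, ∀ y ∈ S, κ ^ 2 < φ v x * φ v y) → ν S = 0 := by
    intro S hS
    have h0 : (ν.prod ν) (S ×ˢ S) = 0 := by
      refine measure_mono_null ?_ (ae_iff.1 hv)
      rintro ⟨x, y⟩ ⟨hx, hy⟩
      exact not_le.2 (hS x hx y hy)
    rw [Measure.prod_prod] at h0
    simpa using h0
  have h1 : ∀ᵐ x ∂ν, ¬ κ < φ v x := by
    rw [ae_iff]; simp only [not_not]
    exact key _ fun x hx y hy => by
      simp only [Set.mem_ofPred_eq] at hx hy; nlinarith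
  have h2 : ∀ᵐ x ∂ν, ¬ φ v x < -κ := by
    rw [ae_iff]; simp only [not_not]
    exact key _ fun x hx y hy => by
      simp only [Set.mem_ofPred_eq] at hx hy; nlinarith
  filter_upwards [h1, h2] with x h1 h2
  exact abs_le.2 ⟨not_lt.1 h2, not_lt.1 h1⟩

theorem memLp_feature (hφ : Measurable (Function.uncurry φ)) {v : V}
    (hv : ∀ᵐ x ∂ν, |φ v x| ≤ κ) : MemLp (φ v) 2 ν :=
  MemLp.of_bound (hφ.comp measurable_prodMk_left).aestronglyMeasurable κ hv

open Classical in
/-- The random feature `φ_v` as an element of `L²(ν)` (zero if it is not square integrable). -/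
def featureLp (ν : Measure α) (φ : V → α → ℝ) (v : V) : Lp ℝ 2 ν :=
  if h : MemLp (φ v) 2 ν then h.toLp else 0

theorem coeFn_featureLp {v : V} (h : MemLp (φ v) 2 ν) : featureLp ν φ v =ᵐ[ν] φ v := by
  rw [featureLp, dif_pos h]; exact h.coeFn_toLp

theorem inner_eq_integral_mul (f g : Lp ℝ 2 ν) : inner ℝ f g = ∫ x, f x * g x ∂ν := by
  rw [L2.inner_def]
  exact integral_congr_ae (Filter.Eventually.of_forall fun x => by simp [mul_comm])

theorem inner_featureLp {v : V} (h : MemLp (φ v) 2 ν) (g : Lp ℝ 2 ν) :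
    inner ℝ (featureLp ν φ v) g = ∫ x, φ v x * g x ∂ν := by
  rw [inner_eq_integral_mul]
  refine integral_congr_ae ?_
  filter_upwards [coeFn_featureLp h] with x hx
  rw [hx]

theorem norm_featureLp_le (hφ : Measurable (Function.uncurry φ)) (hκ : 0 ≤ κ) {v : V}
    (hv : ∀ᵐ x ∂ν, |φ v x| ≤ κ) : ‖featureLp ν φ v‖ ≤ κ := by
  have h := memLp_feature hφ hv
  rw [featureLp, dif_pos h]
  have := Lp.norm_le_of_ae_bound (f := h.toLp) hκ (by
    filter_upwards [h.coeFn_toLp, hv] with x hx hv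
    rw [hx]; exact hv)
  simpa [measureUnivNNReal] using this

/-- Pairings with a fixed `g` are parameter integrals, measurable by Fubini on the measurable set of
`v` with square-integrable `φ_v`; separability upgrades this weak measurability. -/
theorem stronglyMeasurable_featureLp [SecondCountableTopology (Lp ℝ 2 ν)]
    (hφ : Measurable (Function.uncurry φ)) : StronglyMeasurable (featureLp ν φ) := by
  refine stronglyMeasurable_of_inner fun g => ?_
  have hset : MeasurableSet {v | MemLp (φ v) 2 ν} := by
    have e : {v | MemLp (φ v) 2 ν} = {v | ∫⁻ x, ‖φ v x‖ₑ ^ (2 : ℝ) ∂ν < ∞} := by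
      ext v
      have := eLpNorm_lt_top_iff_lintegral_rpow_enorm_lt_top (f := φ v) (μ := ν) (p := 2)
        (by norm_num) (by norm_num)
      simp only [ENNReal.toReal_ofNat] at this
      simp only [Set.mem_ofPred_eq]
      exact ⟨fun h => this.1 h.2,
        fun h => ⟨(hφ.comp measurable_prodMk_left).aestronglyMeasurable, this.2 h⟩⟩
    rw [e]
    exact measurableSet_lt (Measurable.lintegral_prod_right' (f := fun p : V × α =>
      ‖φ p.1 p.2‖ₑ ^ (2 : ℝ)) (hφ.enorm.pow_const _)) measurable_const
  have hint : Measurable fun v => ∫ x, φ v x * g x ∂ν := by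
    refine StronglyMeasurable.measurable (StronglyMeasurable.integral_prod_right'
      (f := fun p : V × α => φ p.1 p.2 * g p.2) ?_)
    exact hφ.stronglyMeasurable.mul ((Lp.stronglyMeasurable g).comp_measurable measurable_snd)
  have e : (fun v => inner ℝ g (featureLp ν φ v))
      = {v | MemLp (φ v) 2 ν}.indicator fun v => ∫ x, φ v x * g x ∂ν := by
    ext v
    by_cases h : MemLp (φ v) 2 ν
    · rw [Set.indicator_of_mem (by exact h), real_inner_comm, inner_featureLp h]
    · rw [Set.indicator_of_notMem (by exact h), featureLp, dif_neg h, inner_zero_right]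
  rw [e]
  exact hint.indicator hset

theorem ae_prod_abs_le (hφ : Measurable (Function.uncurry φ))
    (hb : ∀ᵐ v ∂μ, ∀ᵐ x ∂ν, |φ v x| ≤ κ) : ∀ᵐ p ∂(μ.prod ν), |φ p.1 p.2| ≤ κ := by
  rw [Measure.ae_prod_iff_ae_ae]
  · exact hb
  · exact measurableSet_le (continuous_abs.measurable.comp hφ) measurable_const

variable {K : α → α → ℝ}

/-- The identity `L_K = E[φ_v ⊗ φ_v]` in weak form, by Fubini; the almost sure bound on the features
provides the integrability. -/
theorem inner_integralOperator (hφ : Measurable (Function.uncurry φ))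
    (hb : ∀ᵐ v ∂μ, ∀ᵐ x ∂ν, |φ v x| ≤ κ) (hK : ∀ x x', K x x' = ∫ v, φ v x * φ v x' ∂μ)
    (hK2 : MemLp (Function.uncurry K) 2 (ν.prod ν)) (f g : Lp ℝ 2 ν) :
    inner ℝ (integralOperator ν K f) g
      = ∫ v, inner ℝ (featureLp ν φ v) f * inner ℝ (featureLp ν φ v) g ∂μ := by
  have hf : Integrable f ν := (Lp.memLp f).integrable one_le_two
  have hg : Integrable g ν := (Lp.memLp g).integrable one_le_two
  have hfg : Integrable (fun q : α × α => f q.1 * g q.2) (ν.prod ν) := hf.mul_prod hg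
  have hm1 : Measurable fun p : V × α × α => φ p.1 p.2.1 :=
    hφ.comp (measurable_fst.prodMk (measurable_fst.comp measurable_snd))
  have hm2 : Measurable fun p : V × α × α => φ p.1 p.2.2 :=
    hφ.comp (measurable_fst.prodMk (measurable_snd.comp measurable_snd))
  have hbd : ∀ᵐ p ∂(μ.prod (ν.prod ν)), ‖φ p.1 p.2.1 * φ p.1 p.2.2‖ ≤ κ * κ := by
    rw [Measure.ae_prod_iff_ae_ae]
    · filter_upwards [hb] with v hv
      filter_upwards [Measure.quasiMeasurePreserving_fst.ae hv,
        Measure.quasiMeasurePreserving_snd.ae hv] with q h1 h2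
      rw [norm_mul]
      exact mul_le_mul h1 h2 (abs_nonneg _) ((abs_nonneg _).trans h1)
    · exact measurableSet_le (hm1.mul hm2).norm measurable_const
  have hint : Integrable (fun p : V × α × α => φ p.1 p.2.1 * φ p.1 p.2.2 * (f p.2.1 * g p.2.2))
      (μ.prod (ν.prod ν)) :=
    (hfg.comp_snd μ).bdd_mul (hm1.mul hm2).aestronglyMeasurable hbd
  have e1 : ∫ v, inner ℝ (featureLp ν φ v) f * inner ℝ (featureLp ν φ v) g ∂μ
      = ∫ v, ∫ q, φ v q.1 * φ v q.2 * (f q.1 * g q.2) ∂(ν.prod ν) ∂μ := by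
    refine integral_congr_ae ?_
    filter_upwards [hb] with v hv
    have h := memLp_feature hφ hv
    rw [inner_featureLp h, inner_featureLp h, ← integral_prod_mul]
    congr 1; ext q; ring
  have e2 : ∀ q : α × α, ∫ v, φ v q.1 * φ v q.2 * (f q.1 * g q.2) ∂μ
      = K q.1 q.2 * f q.1 * g q.2 := fun q => by
    rw [integral_mul_const, hK, mul_assoc]
  rw [e1, integral_integral_swap hint]
  simp only [e2]
  rw [integral_prod_symm, inner_eq_integral_mul]
  · refine integral_congr_ae ?_
    filter_upwards [integralOperator_ae_eq hK2 f] with u hu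
    rw [hu, integral_mul_const]
  · simpa only [e2] using hint.integral_prod_right

theorem integrable_inner_featureLp_mul [SecondCountableTopology (Lp ℝ 2 ν)]
    (hφ : Measurable (Function.uncurry φ)) (hκ : 0 ≤ κ)
    (hb : ∀ᵐ v ∂μ, ∀ᵐ x ∂ν, |φ v x| ≤ κ) (f g : Lp ℝ 2 ν) :
    Integrable (fun v => inner ℝ (featureLp ν φ v) f * inner ℝ (featureLp ν φ v) g) μ := by
  have hm := stronglyMeasurable_featureLp (ν := ν) hφ
  refine Integrable.of_bound (((hm.inner stronglyMeasurable_const).mul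
    (hm.inner stronglyMeasurable_const)).aestronglyMeasurable) (κ * ‖f‖ * (κ * ‖g‖)) ?_
  filter_upwards [hb] with v hv
  have hn := norm_featureLp_le hφ hκ hv
  rw [norm_mul]
  gcongr
  · exact (norm_inner_le_norm _ _).trans (by gcongr)
  · exact (norm_inner_le_norm _ _).trans (by gcongr)

theorem isPositive_integralOperator (hφ : Measurable (Function.uncurry φ))
    (hb : ∀ᵐ v ∂μ, ∀ᵐ x ∂ν, |φ v x| ≤ κ) (hK : ∀ x x', K x x' = ∫ v, φ v x * φ v x' ∂μ)
    (hK2 : MemLp (Function.uncurry K) 2 (ν.prod ν)) : (integralOperator ν K).IsPositive := by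
  rw [ContinuousLinearMap.isPositive_iff]
  refine ⟨fun f g => ?_, fun f => ?_⟩
  · change inner ℝ (integralOperator ν K f) g = inner ℝ f (integralOperator ν K g)
    rw [← real_inner_comm f, inner_integralOperator hφ hb hK hK2,
      inner_integralOperator hφ hb hK hK2]
    simp only [mul_comm]
  · rw [inner_integralOperator hφ hb hK hK2]
    exact integral_nonneg fun v => mul_self_nonneg _

theorem isPositive_one_sub_integralOperator [SecondCountableTopology (Lp ℝ 2 ν)]
    (hφ : Measurable (Function.uncurry φ)) (hκ : 0 ≤ κ)
    (hb : ∀ᵐ v ∂μ, ∀ᵐ x ∂ν, |φ v x| ≤ κ) (hK : ∀ x x', K x x' = ∫ v, φ v x * φ v x' ∂μ)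
    (hK2 : MemLp (Function.uncurry K) 2 (ν.prod ν)) {η : ℝ} (hη : 0 ≤ η) (hηκ : η * κ ^ 2 ≤ 1) :
    (1 - η • integralOperator ν K).IsPositive := by
  have hL := isPositive_integralOperator hφ hb hK hK2
  rw [ContinuousLinearMap.isPositive_iff]
  refine ⟨(ContinuousLinearMap.isPositive_one.isSymmetric).sub
    (hL.smul_of_nonneg hη).isSymmetric, fun f => ?_⟩
  have h : inner ℝ (integralOperator ν K f) f ≤ κ ^ 2 * ‖f‖ ^ 2 := by
    rw [inner_integralOperator hφ hb hK hK2]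
    have := integral_mono_ae (integrable_inner_featureLp_mul hφ hκ hb f f)
      (integrable_const (κ ^ 2 * ‖f‖ ^ 2)) (by
        filter_upwards [hb] with v hv
        have hn := norm_featureLp_le hφ hκ hv
        have h1 : |inner ℝ (featureLp ν φ v) f| ≤ κ * ‖f‖ :=
          (abs_real_inner_le_norm _ _).trans (by gcongr)
        rw [← sq, ← sq_abs, ← mul_pow]
        gcongr)
    simpa using this
  simp only [sub_apply, one_apply_eq_self, smul_apply, inner_sub_left, inner_smul_left,
    real_inner_self_eq_norm_sq, conj_trivial]
  nlinarith [sq_nonneg ‖f‖, mul_le_mul_of_nonneg_left h hη]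

/-- Parseval for `A φ_v`, with `A` moved onto the basis vectors by symmetry. The right side is the
trace of `A L_K A`, here comparable term by term with `effectiveDimension`. -/
theorem lintegral_norm_featureLp_eq_tsum [SecondCountableTopology (Lp ℝ 2 ν)]
    (hφ : Measurable (Function.uncurry φ)) (hκ : 0 ≤ κ)
    (hb : ∀ᵐ v ∂μ, ∀ᵐ x ∂ν, |φ v x| ≤ κ) (hK : ∀ x x', K x x' = ∫ v, φ v x * φ v x' ∂μ)
    (hK2 : MemLp (Function.uncurry K) 2 (ν.prod ν)) {A : Lp ℝ 2 ν →L[ℝ] Lp ℝ 2 ν}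
    (hA : A.IsPositive) {ι : Type*} (b : HilbertBasis ι ℝ (Lp ℝ 2 ν)) :
    ∫⁻ v, ENNReal.ofReal (‖A (featureLp ν φ v)‖ ^ 2) ∂μ
      = ∑' i, ENNReal.ofReal (inner ℝ (integralOperator ν K (A (b i))) (A (b i))) := by
  have : Countable ι := countable_of_orthonormal b.orthonormal
  have hm := stronglyMeasurable_featureLp (ν := ν) hφ
  have e : ∀ v, ENNReal.ofReal (‖A (featureLp ν φ v)‖ ^ 2)
      = ∑' i, ENNReal.ofReal (inner ℝ (featureLp ν φ v) (A (b i))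
          * inner ℝ (featureLp ν φ v) (A (b i))) := fun v => by
    have h := b.hasSum_inner_mul_inner (A (featureLp ν φ v)) (A (featureLp ν φ v))
    have e2 : ∀ i, inner ℝ (A (featureLp ν φ v)) (b i) * inner ℝ (b i) (A (featureLp ν φ v))
        = inner ℝ (featureLp ν φ v) (A (b i)) * inner ℝ (featureLp ν φ v) (A (b i)) := fun i => by
      rw [real_inner_comm _ (b i), hA.isSymmetric.apply_clm]
    simp only [e2] at h
    rw [← real_inner_self_eq_norm_sq, ← h.tsum_eq,
      ENNReal.ofReal_tsum_of_nonneg (fun i => mul_self_nonneg _) h.summable]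
  simp only [e]
  rw [lintegral_tsum]
  · refine tsum_congr fun i => ?_
    rw [inner_integralOperator hφ hb hK hK2, ofReal_integral_eq_lintegral_ofReal]
    · exact integrable_inner_featureLp_mul hφ hκ hb _ _
    · exact Filter.Eventually.of_forall fun v => mul_self_nonneg _
  · intro i
    exact (((hm.inner stronglyMeasurable_const).mul
      (hm.inner stronglyMeasurable_const)).measurable.ennreal_ofReal).aemeasurable

theorem lintegral_norm_damped_featureLp_le [SecondCountableTopology (Lp ℝ 2 ν)]
    (hφ : Measurable (Function.uncurry φ)) (hκ : 0 ≤ κ)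
    (hb : ∀ᵐ v ∂μ, ∀ᵐ x ∂ν, |φ v x| ≤ κ) (hK : ∀ x x', K x x' = ∫ v, φ v x * φ v x' ∂μ)
    (hK2 : MemLp (Function.uncurry K) 2 (ν.prod ν)) {η : ℝ} (hη : 0 < η) (hηκ : η * κ ^ 2 ≤ 1)
    {γ cγ : ℝ} (hcγ : 0 < cγ)
    (heff : ∀ lam : ℝ, 0 < lam →
      effectiveDimension (integralOperator ν K) lam ≤ ENNReal.ofReal (cγ * lam ^ (-γ)))
    {k : ℕ} (hk : k ≠ 0) :
    ∫⁻ v, ENNReal.ofReal (‖((1 - η • integralOperator ν K) ^ k) (featureLp ν φ v)‖ ^ 2) ∂μ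
      ≤ ENNReal.ofReal (2 * cγ * (η * k) ^ (γ - 1)) := by
  have hL := isPositive_integralOperator hφ hb hK hK2
  have h1 := isPositive_one_sub_integralOperator hφ hκ hb hK hK2 hη.le hηκ
  have hA : ((1 - η • integralOperator ν K) ^ k).IsPositive := by
    simpa using isPositive_pow_mul_one_sub_pow (hL.smul_of_nonneg hη.le) h1 0 k
  have hk' : (0 : ℝ) < k := by positivity
  rw [lintegral_norm_featureLp_eq_tsum hφ hκ hb hK hK2 hA
    (exists_hilbertBasis ℝ (Lp ℝ 2 ν)).choose_spec.choose]
  -- The choice `lam = 1/(ηk)` balances the two summands of the factor `lam + 1/(2ηk)`.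
  refine (tsum_inner_damped_le hL hη h1 hk (lam := 1 / (η * k)) (by positivity)).trans ?_
  refine (mul_le_mul_right (heff _ (by positivity)) _).trans ?_
  rw [← ENNReal.ofReal_mul (by positivity)]
  refine ENNReal.ofReal_le_ofReal ?_
  have e : (1 / (η * k)) ^ (-γ) = (η * k) ^ γ := by
    rw [one_div, Real.inv_rpow (by positivity), Real.rpow_neg (by positivity), inv_inv]
  rw [e, Real.rpow_sub_one (by positivity)]
  have e2 : 1 / (2 * η * k) ≤ 1 / (η * k) := by
    apply one_div_le_one_div_of_le (by positivity); nlinarith [mul_pos hη hk']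
  calc (1 / (η * k) + 1 / (2 * η * k)) * (cγ * (η * k) ^ γ)
      ≤ (1 / (η * k) + 1 / (η * k)) * (cγ * (η * k) ^ γ) := by gcongr
    _ = _ := by ring

theorem lintegral_norm_featureLp_le (hφ : Measurable (Function.uncurry φ)) (hκ : 0 ≤ κ)
    (hb : ∀ᵐ v ∂μ, ∀ᵐ x ∂ν, |φ v x| ≤ κ) :
    ∫⁻ v, ENNReal.ofReal (‖featureLp ν φ v‖ ^ 2) ∂μ ≤ ENNReal.ofReal (κ ^ 2) := by
  have : ∫⁻ v, ENNReal.ofReal (‖featureLp ν φ v‖ ^ 2) ∂μ ≤ ∫⁻ _, ENNReal.ofReal (κ ^ 2) ∂μ := by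
    refine lintegral_mono_ae ?_
    filter_upwards [hb] with v hv
    have := norm_featureLp_le hφ hκ hv
    gcongr
  simpa using this

end Features

/-! ### Conditional expectation of one stochastic step -/

section OneStep

variable {α V : Type*} [MeasurableSpace α] [MeasurableSpace V] {ρ : Measure (α × ℝ)}
  [IsProbabilityMeasure ρ] {μ : Measure V} [IsProbabilityMeasure μ] {φ : V → α → ℝ} {κ : ℝ}

theorem measurePreserving_fst_measure : MeasurePreserving Prod.fst ρ ρ.fst :=
  ⟨measurable_fst, rfl⟩

theorem memLp_snd (hy : Integrable (fun p : α × ℝ => p.2 ^ 2) ρ) :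
    MemLp (fun p : α × ℝ => p.2) 2 ρ :=
  (memLp_two_iff_integrable_sq measurable_snd.aestronglyMeasurable).2 hy

theorem memLp_comp_fst {h : α → ℝ} (hh : MemLp h 2 ρ.fst) :
    MemLp (fun p : α × ℝ => h p.1) 2 ρ :=
  hh.comp_measurePreserving measurePreserving_fst_measure

theorem integral_comp_fst {h : α → ℝ} (hh : AEStronglyMeasurable h ρ.fst) :
    ∫ p, h p.1 ∂ρ = ∫ x, h x ∂ρ.fst :=
  (integral_map measurable_fst.aemeasurable hh).symm

theorem integral_mul_snd_eq (hy : Integrable (fun p : α × ℝ => p.2 ^ 2) ρ) {h : α → ℝ}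
    (hh : MemLp h 2 ρ.fst) :
    ∫ p, h p.1 * p.2 ∂ρ = ∫ x, h x * regressionFunction ρ x ∂ρ.fst := by
  have hint : Integrable (fun p : α × ℝ => h p.1 * p.2) ρ :=
    (memLp_comp_fst hh).integrable_mul (memLp_snd hy)
  rw [← Measure.integral_condKernel hint]
  refine integral_congr_ae (Filter.Eventually.of_forall fun x => ?_)
  change ∫ y, h x * y ∂(ρ.condKernel x) = h x * ∫ y, y ∂(ρ.condKernel x)
  rw [integral_const_mul]

variable {e : Lp ℝ 2 ρ.fst} {f : α → ℝ}

/-- The residual `f(x) - y` is orthogonal to `h(x)` up to the excess `f - f_ρ`. -/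
theorem integral_residual_mul (hy : Integrable (fun p : α × ℝ => p.2 ^ 2) ρ)
    (hr : MemLp (regressionFunction ρ) 2 ρ.fst)
    (he : e =ᵐ[ρ.fst] fun x => f x - regressionFunction ρ x) {h : α → ℝ}
    (hh : MemLp h 2 ρ.fst) :
    ∫ p, (f p.1 - p.2) * h p.1 ∂ρ = ∫ x, e x * h x ∂ρ.fst := by
  have hf : MemLp f 2 ρ.fst := by
    refine ((Lp.memLp e).add hr).ae_eq ?_
    filter_upwards [he] with x hx
    simp [hx]
  have i1 : Integrable (fun p : α × ℝ => f p.1 * h p.1) ρ :=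
    (memLp_comp_fst hf).integrable_mul (memLp_comp_fst hh)
  have i2 : Integrable (fun p : α × ℝ => h p.1 * p.2) ρ :=
    (memLp_comp_fst hh).integrable_mul (memLp_snd hy)
  have e1 : ∫ p, (f p.1 - p.2) * h p.1 ∂ρ
      = ∫ p, f p.1 * h p.1 ∂ρ - ∫ p, h p.1 * p.2 ∂ρ := by
    rw [← integral_sub i1 i2]; congr 1; ext p; ring
  have j1 : Integrable (fun x => f x * h x) ρ.fst := hf.integrable_mul hh
  have j2 : Integrable (fun x => h x * regressionFunction ρ x) ρ.fst := hh.integrable_mul hr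
  rw [e1, integral_mul_snd_eq hy hh,
    integral_comp_fst (h := fun x => f x * h x) (hf.1.mul hh.1),
    ← integral_sub j1 j2]
  refine integral_congr_ae ?_
  filter_upwards [he] with x hx
  rw [hx]; ring

theorem integral_residual_sq (hy : Integrable (fun p : α × ℝ => p.2 ^ 2) ρ)
    (hr : MemLp (regressionFunction ρ) 2 ρ.fst)
    (he : e =ᵐ[ρ.fst] fun x => f x - regressionFunction ρ x) :
    ∫ p, (f p.1 - p.2) ^ 2 ∂ρ = ‖e‖ ^ 2 + expectedRisk ρ (regressionFunction ρ) := by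
  have he2 := Lp.memLp e
  have hrr : MemLp (fun p : α × ℝ => regressionFunction ρ p.1 - p.2) 2 ρ :=
    (memLp_comp_fst hr).sub (memLp_snd hy)
  have hep := memLp_comp_fst he2
  have i1 : Integrable (fun p : α × ℝ => e p.1 * e p.1) ρ := hep.integrable_mul hep
  have i2 : Integrable (fun p : α × ℝ => (regressionFunction ρ p.1 - p.2) * e p.1) ρ :=
    hrr.integrable_mul hep
  have i3 : Integrable (fun p : α × ℝ => (regressionFunction ρ p.1 - p.2) ^ 2) ρ :=
    hrr.integrable_sq
  have i12 : Integrable (fun p : α × ℝ => e p.1 * e p.1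
      + 2 * ((regressionFunction ρ p.1 - p.2) * e p.1)) ρ := i1.add (i2.const_mul 2)
  -- With zero excess, the residual of the regression function is orthogonal to `e`, which kills the
  -- cross term.
  have z := integral_residual_mul (e := 0) (f := regressionFunction ρ) hy hr (by
    filter_upwards [Lp.coeFn_zero ℝ 2 ρ.fst] with x hx; rw [hx]; simp) he2
  have z0 : ∫ x, (0 : Lp ℝ 2 ρ.fst) x * e x ∂ρ.fst = 0 := by
    rw [← inner_eq_integral_mul, inner_zero_left]
  have hex := measurePreserving_fst_measure.quasiMeasurePreserving.ae he
  calc ∫ p, (f p.1 - p.2) ^ 2 ∂ρ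
      = ∫ p, (e p.1 * e p.1 + 2 * ((regressionFunction ρ p.1 - p.2) * e p.1))
          + (regressionFunction ρ p.1 - p.2) ^ 2 ∂ρ := by
        refine integral_congr_ae ?_
        filter_upwards [hex] with p hp
        rw [hp]; ring
    _ = ∫ x, e x * e x ∂ρ.fst + 2 * 0 + expectedRisk ρ (regressionFunction ρ) := by
        rw [integral_add i12 i3, integral_add i1 (i2.const_mul 2),
          integral_const_mul, z, z0, integral_comp_fst (h := fun x => e x * e x) (he2.1.mul he2.1)]
        rfl
    _ = _ := by rw [← inner_eq_integral_mul, real_inner_self_eq_norm_sq]; ring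

theorem memLp_residual (hy : Integrable (fun p : α × ℝ => p.2 ^ 2) ρ)
    (hr : MemLp (regressionFunction ρ) 2 ρ.fst)
    (he : e =ᵐ[ρ.fst] fun x => f x - regressionFunction ρ x) :
    MemLp (fun p : α × ℝ => f p.1 - p.2) 2 ρ := by
  have hf : MemLp f 2 ρ.fst := by
    refine ((Lp.memLp e).add hr).ae_eq ?_
    filter_upwards [he] with x hx
    simp [hx]
  exact (memLp_comp_fst hf).sub (memLp_snd hy)

/-- Expanding the square, the cross term averages to `-2η⟪A L e, A e⟫`. In the quadratic term
`φ_v(x)²` is bounded by `κ²`, after which the dependence on `v` and on `(x, y)` factorizes. -/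
theorem lintegral_step_le [SecondCountableTopology (Lp ℝ 2 ρ.fst)] {K : α → α → ℝ}
    (hφ : Measurable (Function.uncurry φ)) (hκ : 0 ≤ κ)
    (hb : ∀ᵐ v ∂μ, ∀ᵐ x ∂ρ.fst, |φ v x| ≤ κ) (hK : ∀ x x', K x x' = ∫ v, φ v x * φ v x' ∂μ)
    (hK2 : MemLp (Function.uncurry K) 2 (ρ.fst.prod ρ.fst))
    (hy : Integrable (fun p : α × ℝ => p.2 ^ 2) ρ)
    (hr : MemLp (regressionFunction ρ) 2 ρ.fst)
    (he : e =ᵐ[ρ.fst] fun x => f x - regressionFunction ρ x)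
    {A : Lp ℝ 2 ρ.fst →L[ℝ] Lp ℝ 2 ρ.fst} (hA : A.IsPositive) (η : ℝ) :
    ∫⁻ q, ENNReal.ofReal (‖A (e - (η * (f q.1.1 - q.1.2) * φ q.2 q.1.1) •
        featureLp ρ.fst φ q.2)‖ ^ 2) ∂(ρ.prod μ)
      ≤ ENNReal.ofReal (‖A (e - η • integralOperator ρ.fst K e)‖ ^ 2)
        + ENNReal.ofReal (η ^ 2 * κ ^ 2)
          * (∫⁻ v, ENNReal.ofReal (‖A (featureLp ρ.fst φ v)‖ ^ 2) ∂μ)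
          * (ENNReal.ofReal (‖e‖ ^ 2) + ENNReal.ofReal (expectedRisk ρ (regressionFunction ρ))) := by
  set Φ := featureLp ρ.fst φ with hΦ
  have hm : StronglyMeasurable Φ := stronglyMeasurable_featureLp hφ
  have hAm : StronglyMeasurable fun v => A (Φ v) := A.continuous.comp_stronglyMeasurable hm
  have hc := memLp_residual hy hr he
  have hc2 : Integrable (fun p : α × ℝ => (f p.1 - p.2) ^ 2) ρ := hc.integrable_sq
  have hc1 : Integrable (fun p : α × ℝ => f p.1 - p.2) ρ := hc.integrable one_le_two
  have hmp : MeasurePreserving (fun q : (α × ℝ) × V => (q.2, q.1.1)) (ρ.prod μ)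
      (μ.prod ρ.fst) :=
    Measure.measurePreserving_swap.comp
      (measurePreserving_fst_measure.prod (MeasurePreserving.id μ))
  have hφq : Measurable fun q : (α × ℝ) × V => φ q.2 q.1.1 := hφ.comp hmp.measurable
  have hbq : ∀ᵐ q ∂(ρ.prod μ), |φ q.2 q.1.1| ≤ κ :=
    hmp.quasiMeasurePreserving.ae (ae_prod_abs_le hφ hb)
  have hΦq : ∀ᵐ q ∂(ρ.prod μ), ‖Φ q.2‖ ≤ κ := by
    refine Measure.quasiMeasurePreserving_snd.ae (p := fun v => ‖Φ v‖ ≤ κ) ?_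
    filter_upwards [hb] with v hv using norm_featureLp_le hφ hκ hv
  set cross : (α × ℝ) × V → ℝ := fun q =>
    (φ q.2 q.1.1 * inner ℝ (Φ q.2) (A (A e))) * (f q.1.1 - q.1.2) with hcross
  set quad : (α × ℝ) × V → ℝ := fun q =>
    (φ q.2 q.1.1 ^ 2 * ‖A (Φ q.2)‖ ^ 2) * (f q.1.1 - q.1.2) ^ 2 with hquad
  have i1 : Integrable cross (ρ.prod μ) := by
    refine (hc1.comp_fst μ).bdd_mul (c := κ * (κ * ‖A (A e)‖)) (hφq.aestronglyMeasurable.mul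
      ((hm.comp_measurable measurable_snd).inner stronglyMeasurable_const).aestronglyMeasurable) ?_
    filter_upwards [hbq, hΦq] with q h1 h2
    rw [norm_mul]
    gcongr
    · exact h1
    · exact (norm_inner_le_norm _ _).trans (by gcongr)
  have i2 : Integrable quad (ρ.prod μ) := by
    refine (hc2.comp_fst μ).bdd_mul (c := κ ^ 2 * (‖A‖ * κ) ^ 2)
      ((hφq.pow_const 2).aestronglyMeasurable.mul
      ((hAm.comp_measurable measurable_snd).norm.pow 2).aestronglyMeasurable) ?_
    filter_upwards [hbq, hΦq] with q h1 h2
    rw [norm_mul, norm_pow, norm_pow, norm_norm]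
    gcongr
    · exact h1
    · exact (A.le_opNorm _).trans (by gcongr)
  have expand : ∀ q : (α × ℝ) × V,
      ‖A (e - (η * (f q.1.1 - q.1.2) * φ q.2 q.1.1) • Φ q.2)‖ ^ 2
        = ‖A e‖ ^ 2 - 2 * η * cross q + η ^ 2 * quad q := fun q => by
    have h : inner ℝ (A e) (A (Φ q.2)) = inner ℝ (Φ q.2) (A (A e)) := by
      rw [real_inner_comm, hA.isSymmetric.apply_clm]
    rw [map_sub, map_smul, norm_sub_sq_real, inner_smul_right, norm_smul, hcross, hquad]
    simp only [mul_pow, Real.norm_eq_abs, sq_abs]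
    rw [h]
    ring
  have hI1 : ∫ q, cross q ∂(ρ.prod μ) = inner ℝ (A (integralOperator ρ.fst K e)) (A e) := by
    rw [integral_prod_symm _ i1, hA.isSymmetric.apply_clm,
      inner_integralOperator hφ hb hK hK2]
    refine integral_congr_ae ?_
    filter_upwards [hb] with v hv
    have hv2 := memLp_feature hφ hv
    rw [inner_featureLp hv2 e]
    have h := integral_residual_mul hy hr he hv2
    have e1 : ∀ p : α × ℝ, cross (p, v)
        = inner ℝ (Φ v) (A (A e)) * ((f p.1 - p.2) * φ v p.1) := fun p => by
      simp only [hcross]; ring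
    simp only [e1]
    rw [integral_const_mul, h, mul_comm]
    simp only [mul_comm]
    rfl
  have hI2 : ENNReal.ofReal (∫ q, η ^ 2 * quad q ∂(ρ.prod μ))
      ≤ ENNReal.ofReal (η ^ 2 * κ ^ 2) * (∫⁻ v, ENNReal.ofReal (‖A (Φ v)‖ ^ 2) ∂μ)
          * (ENNReal.ofReal (‖e‖ ^ 2)
            + ENNReal.ofReal (expectedRisk ρ (regressionFunction ρ))) := by
    rw [ofReal_integral_eq_lintegral_ofReal (i2.const_mul _)
      (Filter.Eventually.of_forall fun q => by simp only [hquad]; positivity)]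
    have hrisk : 0 ≤ expectedRisk ρ (regressionFunction ρ) := integral_nonneg fun p => sq_nonneg _
    calc ∫⁻ q, ENNReal.ofReal (η ^ 2 * quad q) ∂(ρ.prod μ)
        ≤ ∫⁻ q, ENNReal.ofReal (η ^ 2 * κ ^ 2) * (ENNReal.ofReal ((f q.1.1 - q.1.2) ^ 2)
            * ENNReal.ofReal (‖A (Φ q.2)‖ ^ 2)) ∂(ρ.prod μ) := by
          refine lintegral_mono_ae ?_
          filter_upwards [hbq] with q h1
          rw [← ENNReal.ofReal_mul (by positivity), ← ENNReal.ofReal_mul (by positivity)]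
          refine ENNReal.ofReal_le_ofReal ?_
          have h2 : φ q.2 q.1.1 ^ 2 ≤ κ ^ 2 := by rw [← sq_abs]; gcongr
          calc η ^ 2 * quad q = η ^ 2 * (φ q.2 q.1.1 ^ 2) *
                ((f q.1.1 - q.1.2) ^ 2 * ‖A (Φ q.2)‖ ^ 2) := by simp only [hquad]; ring
            _ ≤ _ := by gcongr
      _ = ENNReal.ofReal (η ^ 2 * κ ^ 2) * ((∫⁻ p, ENNReal.ofReal ((f p.1 - p.2) ^ 2) ∂ρ)
            * ∫⁻ v, ENNReal.ofReal (‖A (Φ v)‖ ^ 2) ∂μ) := by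
          rw [lintegral_const_mul' _ _ ENNReal.ofReal_ne_top]
          congr 1
          exact lintegral_prod_mul hc2.1.aemeasurable.ennreal_ofReal
            (hAm.norm.pow 2).measurable.ennreal_ofReal.aemeasurable
      _ = _ := by
          rw [← ofReal_integral_eq_lintegral_ofReal hc2
            (Filter.Eventually.of_forall fun p => sq_nonneg _), integral_residual_sq hy hr he,
            ENNReal.ofReal_add (by positivity) hrisk]
          ring
  have i01 : Integrable (fun q => ‖A e‖ ^ 2 - 2 * η * cross q) (ρ.prod μ) :=
    (integrable_const _).sub (i1.const_mul _)
  have iAll : Integrable (fun q => ‖A e‖ ^ 2 - 2 * η * cross q + η ^ 2 * quad q) (ρ.prod μ) :=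
    i01.add (i2.const_mul _)
  simp only [expand]
  rw [← ofReal_integral_eq_lintegral_ofReal iAll
    (Filter.Eventually.of_forall fun q => by
      simp only [Pi.zero_apply]; rw [← expand]; positivity),
    integral_add i01 (i2.const_mul _),
    integral_sub (integrable_const _) (i1.const_mul _), integral_const_mul, hI1]
  refine ENNReal.ofReal_add_le.trans (add_le_add (ENNReal.ofReal_le_ofReal ?_) hI2)
  rw [map_sub, map_smul, norm_sub_sq_real, inner_smul_right, real_inner_comm]
  simp only [integral_const, probReal_univ, one_smul]
  -- Completing to `‖A(e - ηLe)‖²` only adds the nonnegative term `‖ηALe‖²`.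
  nlinarith [sq_nonneg ‖η • A (integralOperator ρ.fst K e)‖]

end OneStep

/-! ### The error process and its two-index recursion -/

section Recursion

variable {α V : Type*}

/-- The unregularized iterate after `n` steps, as a function of the `n` samples used. -/
def run (φ : V → α → ℝ) (η : ℝ) : (n : ℕ) → (Fin n → (α × ℝ) × V) → α → ℝ
  | 0, _ => 0
  | n + 1, w => fun x =>
      run φ η n (fun i => w ((Fin.last n).succAbove i)) x
        - η * (run φ η n (fun i => w ((Fin.last n).succAbove i)) (w (Fin.last n)).1.1
            - (w (Fin.last n)).1.2) * φ (w (Fin.last n)).2 (w (Fin.last n)).1.1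
          * φ (w (Fin.last n)).2 x

theorem iterate_eq_run [MeasurableSpace α] (φ : V → α → ℝ) (η : ℝ) (z : ℕ → α × ℝ) (v : ℕ → V)
    (n : ℕ) : iterate φ (fun _ => η) 0 z v (n + 1)
      = run φ η n (fun i => (z (i + 1), v (i + 1))) := by
  induction n with
  | zero => rfl
  | succ n ih =>
    ext x
    rw [iterate, ih, run]
    simp

variable [MeasurableSpace α] [MeasurableSpace V] {ρ : Measure (α × ℝ)}
  [IsProbabilityMeasure ρ] {μ : Measure V} [IsProbabilityMeasure μ] {φ : V → α → ℝ} {κ : ℝ}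

theorem measurable_run (hφ : Measurable (Function.uncurry φ)) (η : ℝ) (n : ℕ) :
    Measurable fun q : (Fin n → (α × ℝ) × V) × α => run φ η n q.1 q.2 := by
  induction n with
  | zero => exact measurable_const
  | succ n ih =>
    have hφ' : ∀ {β : Type _} [MeasurableSpace β] {a : β → V} {b : β → α}, Measurable a →
        Measurable b → Measurable fun x => φ (a x) (b x) :=
      fun ha hb => hφ.comp (ha.prodMk hb)
    have hr : ∀ {β : Type _} [MeasurableSpace β] {a : β → (Fin n → (α × ℝ) × V)} {b : β → α},
        Measurable a → Measurable b → Measurable fun x => run φ η n (a x) (b x) :=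
      fun ha hb => ih.comp (ha.prodMk hb)
    have hw : Measurable fun q : (Fin (n + 1) → (α × ℝ) × V) × α => q.1 (Fin.last n) := by fun_prop
    have hi : Measurable fun q : (Fin (n + 1) → (α × ℝ) × V) × α =>
        fun i => q.1 ((Fin.last n).succAbove i) := by fun_prop
    simp only [run]
    refine (hr hi measurable_snd).sub (Measurable.mul (Measurable.mul (Measurable.mul
      measurable_const ((hr hi hw.fst.fst).sub hw.fst.snd)) (hφ' hw.snd hw.fst.fst))
      (hφ' hw.snd measurable_snd))

/-- The error of the iterate in `L²`, started from the error `-F`. -/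
def runError (ρ : Measure (α × ℝ)) (φ : V → α → ℝ) (η : ℝ) (F : Lp ℝ 2 ρ.fst) :
    (n : ℕ) → (Fin n → (α × ℝ) × V) → Lp ℝ 2 ρ.fst
  | 0, _ => -F
  | n + 1, w => runError ρ φ η F n (fun i => w ((Fin.last n).succAbove i))
      - (η * (run φ η n (fun i => w ((Fin.last n).succAbove i)) (w (Fin.last n)).1.1
            - (w (Fin.last n)).1.2) * φ (w (Fin.last n)).2 (w (Fin.last n)).1.1) •
          featureLp ρ.fst φ (w (Fin.last n)).2

theorem stronglyMeasurable_step [SecondCountableTopology (Lp ℝ 2 ρ.fst)]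
    (hφ : Measurable (Function.uncurry φ)) (η : ℝ) {F : Lp ℝ 2 ρ.fst} {n : ℕ}
    (hF : StronglyMeasurable (runError ρ φ η F n)) :
    StronglyMeasurable fun q : ((α × ℝ) × V) × (Fin n → (α × ℝ) × V) =>
      runError ρ φ η F n q.2 - (η * (run φ η n q.2 q.1.1.1 - q.1.1.2) * φ q.1.2 q.1.1.1) •
          featureLp ρ.fst φ q.1.2 := by
  have h1 : Measurable fun q : ((α × ℝ) × V) × (Fin n → (α × ℝ) × V) =>
      run φ η n q.2 q.1.1.1 :=
    (measurable_run hφ η n).comp (measurable_snd.prodMk measurable_fst.fst.fst)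
  have h2 : Measurable fun q : ((α × ℝ) × V) × (Fin n → (α × ℝ) × V) => φ q.1.2 q.1.1.1 :=
    hφ.comp (measurable_fst.snd.prodMk measurable_fst.fst.fst)
  refine (hF.comp_measurable measurable_snd).sub (StronglyMeasurable.smul
    (((measurable_const.mul (h1.sub measurable_fst.fst.snd)).mul h2).stronglyMeasurable)
    ((stronglyMeasurable_featureLp hφ).comp_measurable measurable_fst.snd))

theorem stronglyMeasurable_runError [SecondCountableTopology (Lp ℝ 2 ρ.fst)]
    (hφ : Measurable (Function.uncurry φ)) (η : ℝ) (F : Lp ℝ 2 ρ.fst) (n : ℕ) :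
    StronglyMeasurable (runError ρ φ η F n) := by
  induction n with
  | zero => exact stronglyMeasurable_const
  | succ n ih =>
    exact (stronglyMeasurable_step hφ η ih).comp_measurable
      (g := MeasurableEquiv.piFinSuccAbove (fun _ => (α × ℝ) × V) (Fin.last n))
      (MeasurableEquiv.measurable _)

/-- An `L²` class has no value at a sample point, so residuals are evaluated on the genuine function
`run`; this ties it to the Hilbert-space error. -/
theorem runError_ae_eq_of_memLp {F : Lp ℝ 2 ρ.fst} (hF : F =ᵐ[ρ.fst] regressionFunction ρ)
    (η : ℝ) {n : ℕ} (w : Fin n → (α × ℝ) × V) (hw : ∀ i, MemLp (φ (w i).2) 2 ρ.fst) :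
    runError ρ φ η F n w =ᵐ[ρ.fst] fun x => run φ η n w x - regressionFunction ρ x := by
  induction n with
  | zero =>
    filter_upwards [Lp.coeFn_neg F, hF] with x h1 h2
    simp only [runError, run, h1, Pi.neg_apply, h2, Pi.zero_apply, zero_sub]
  | succ n ih =>
    filter_upwards [ih (fun i => w ((Fin.last n).succAbove i)) (fun i => hw _),
      coeFn_featureLp (hw (Fin.last n)),
      Lp.coeFn_sub (runError ρ φ η F n (fun i => w ((Fin.last n).succAbove i)))
        ((η * (run φ η n (fun i => w ((Fin.last n).succAbove i)) (w (Fin.last n)).1.1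
            - (w (Fin.last n)).1.2) * φ (w (Fin.last n)).2 (w (Fin.last n)).1.1) •
          featureLp ρ.fst φ (w (Fin.last n)).2),
      Lp.coeFn_smul (η * (run φ η n (fun i => w ((Fin.last n).succAbove i)) (w (Fin.last n)).1.1
            - (w (Fin.last n)).1.2) * φ (w (Fin.last n)).2 (w (Fin.last n)).1.1)
          (featureLp ρ.fst φ (w (Fin.last n)).2)] with x h1 h2 h3 h4
    rw [runError, h3, Pi.sub_apply, h4, Pi.smul_apply, h1, h2, run, smul_eq_mul]
    ring

theorem ae_runError_ae_eq (hφ : Measurable (Function.uncurry φ))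
    (hb : ∀ᵐ v ∂μ, ∀ᵐ x ∂ρ.fst, |φ v x| ≤ κ) {F : Lp ℝ 2 ρ.fst}
    (hF : F =ᵐ[ρ.fst] regressionFunction ρ) (η : ℝ) (n : ℕ) :
    ∀ᵐ w ∂(Measure.pi fun _ : Fin n => ρ.prod μ), runError ρ φ η F n w =ᵐ[ρ.fst]
      fun x => run φ η n w x - regressionFunction ρ x := by
  have h : ∀ᵐ w ∂(Measure.pi fun _ : Fin n => ρ.prod μ), ∀ i, MemLp (φ (w i).2) 2 ρ.fst := by
    rw [ae_all_iff]
    intro i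
    have h1 : ∀ᵐ q ∂(ρ.prod μ), MemLp (φ q.2) 2 ρ.fst := by
      refine Measure.quasiMeasurePreserving_snd.ae (p := fun v => MemLp (φ v) 2 ρ.fst) ?_
      filter_upwards [hb] with v hv using memLp_feature hφ hv
    exact (measurePreserving_eval (fun _ : Fin n => ρ.prod μ) i).quasiMeasurePreserving.ae h1
  filter_upwards [h] with w hw using runError_ae_eq_of_memLp hF η w hw

/-- The second moment of the error after `n` steps, damped by `k` powers of `1 - η L`. -/
def dampedError (ρ : Measure (α × ℝ)) [IsProbabilityMeasure ρ] (μ : Measure V) (φ : V → α → ℝ)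
    (K : α → α → ℝ) (η : ℝ) (F : Lp ℝ 2 ρ.fst) (n k : ℕ) : ℝ≥0∞ :=
  ∫⁻ w, ENNReal.ofReal (‖((1 - η • integralOperator ρ.fst K) ^ k) (runError ρ φ η F n w)‖ ^ 2)
    ∂(Measure.pi fun _ : Fin n => ρ.prod μ)

theorem dampedError_zero (K : α → α → ℝ) (η : ℝ) (F : Lp ℝ 2 ρ.fst) (k : ℕ) :
    dampedError ρ μ φ K η F 0 k
      = ENNReal.ofReal (‖((1 - η • integralOperator ρ.fst K) ^ k) F‖ ^ 2) := by
  simp only [dampedError, runError, map_neg, norm_neg, lintegral_const, measure_univ, mul_one]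

theorem dampedError_succ_le [SecondCountableTopology (Lp ℝ 2 ρ.fst)] {K : α → α → ℝ}
    (hφ : Measurable (Function.uncurry φ)) (hκ : 0 ≤ κ)
    (hb : ∀ᵐ v ∂μ, ∀ᵐ x ∂ρ.fst, |φ v x| ≤ κ) (hK : ∀ x x', K x x' = ∫ v, φ v x * φ v x' ∂μ)
    (hK2 : MemLp (Function.uncurry K) 2 (ρ.fst.prod ρ.fst))
    (hy : Integrable (fun p : α × ℝ => p.2 ^ 2) ρ)
    {F : Lp ℝ 2 ρ.fst} (hF : F =ᵐ[ρ.fst] regressionFunction ρ)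
    {η : ℝ} (hη : 0 < η) (hηκ : η * κ ^ 2 ≤ 1) (n k : ℕ) :
    dampedError ρ μ φ K η F (n + 1) k ≤ dampedError ρ μ φ K η F n (k + 1)
      + ENNReal.ofReal (η ^ 2 * κ ^ 2) * (∫⁻ v, ENNReal.ofReal
          (‖((1 - η • integralOperator ρ.fst K) ^ k) (featureLp ρ.fst φ v)‖ ^ 2) ∂μ)
        * (dampedError ρ μ φ K η F n 0
            + ENNReal.ofReal (expectedRisk ρ (regressionFunction ρ))) := by
  have hr : MemLp (regressionFunction ρ) 2 ρ.fst := (Lp.memLp F).ae_eq hF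
  set A := (1 - η • integralOperator ρ.fst K) ^ k with hA
  have hAp : A.IsPositive := by
    simpa using isPositive_pow_mul_one_sub_pow
      ((isPositive_integralOperator hφ hb hK hK2).smul_of_nonneg hη.le)
      (isPositive_one_sub_integralOperator hφ hκ hb hK hK2 hη.le hηκ) 0 k
  have hm := stronglyMeasurable_step hφ η (stronglyMeasurable_runError hφ η F n)
  have hm2 : Measurable fun q : ((α × ℝ) × V) × (Fin n → (α × ℝ) × V) =>
      ENNReal.ofReal (‖A (runError ρ φ η F n q.2
        - (η * (run φ η n q.2 q.1.1.1 - q.1.1.2) * φ q.1.2 q.1.1.1) •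
          featureLp ρ.fst φ q.1.2)‖ ^ 2) :=
    ((A.continuous.comp_stronglyMeasurable hm).norm.pow 2).measurable.ennreal_ofReal
  -- Splitting off the last sample, independent of the earlier ones, lets the one-step bound be
  -- integrated with the past fixed.
  have e := (measurePreserving_piFinSuccAbove (fun _ : Fin (n + 1) => ρ.prod μ)
    (Fin.last n)).lintegral_comp hm2
  have hm3 : Measurable fun w => ENNReal.ofReal (‖runError ρ φ η F n w‖ ^ 2) :=
    ((stronglyMeasurable_runError hφ η F n).norm.pow 2).measurable.ennreal_ofReal
  have hm5 : Measurable fun w => ENNReal.ofReal (‖runError ρ φ η F n w‖ ^ 2)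
      + ENNReal.ofReal (expectedRisk ρ (regressionFunction ρ)) := hm3.add measurable_const
  have hm4 : Measurable fun w => ENNReal.ofReal
      (‖((1 - η • integralOperator ρ.fst K) ^ (k + 1)) (runError ρ φ η F n w)‖ ^ 2) :=
    ((((1 - η • integralOperator ρ.fst K) ^ (k + 1)).continuous.comp_stronglyMeasurable
      (stronglyMeasurable_runError hφ η F n)).norm.pow 2).measurable.ennreal_ofReal
  calc dampedError ρ μ φ K η F (n + 1) k
      = ∫⁻ q, ENNReal.ofReal (‖A (runError ρ φ η F n q.2
          - (η * (run φ η n q.2 q.1.1.1 - q.1.1.2) * φ q.1.2 q.1.1.1) •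
          featureLp ρ.fst φ q.1.2)‖ ^ 2)
          ∂((ρ.prod μ).prod (Measure.pi fun _ : Fin n => ρ.prod μ)) := by rw [← e]; rfl
    _ = ∫⁻ w, ∫⁻ q, ENNReal.ofReal (‖A (runError ρ φ η F n w
          - (η * (run φ η n w q.1.1 - q.1.2) * φ q.2 q.1.1) •
          featureLp ρ.fst φ q.2)‖ ^ 2) ∂(ρ.prod μ) ∂(Measure.pi fun _ : Fin n => ρ.prod μ) :=
        lintegral_prod_symm _ hm2.aemeasurable
    _ ≤ ∫⁻ w, (ENNReal.ofReal
          (‖((1 - η • integralOperator ρ.fst K) ^ (k + 1)) (runError ρ φ η F n w)‖ ^ 2)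
        + ENNReal.ofReal (η ^ 2 * κ ^ 2)
          * (∫⁻ v, ENNReal.ofReal (‖A (featureLp ρ.fst φ v)‖ ^ 2) ∂μ)
          * (ENNReal.ofReal (‖runError ρ φ η F n w‖ ^ 2)
            + ENNReal.ofReal (expectedRisk ρ (regressionFunction ρ))))
          ∂(Measure.pi fun _ : Fin n => ρ.prod μ) := by
        refine lintegral_mono_ae ?_
        filter_upwards [ae_runError_ae_eq hφ hb hF η n] with w hw
        refine (lintegral_step_le hφ hκ hb hK hK2 hy hr hw hAp η).trans_eq ?_
        rw [pow_succ (1 - η • integralOperator ρ.fst K), mul_apply_eq_comp]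
        rfl
    _ = _ := by
        rw [lintegral_add_left hm4, lintegral_const_mul _ hm5,
          lintegral_add_left hm3]
        simp [dampedError]

end Recursion

/-- Unrolling of `u (n + 1) k ≤ u n (k + 1) + q k * (u n 0 + S)`. -/
theorem le_add_sum_of_recursion {u : ℕ → ℕ → ℝ≥0∞} {q : ℕ → ℝ≥0∞} {S : ℝ≥0∞}
    (h : ∀ n k, u (n + 1) k ≤ u n (k + 1) + q k * (u n 0 + S)) (n k : ℕ) :
    u n k ≤ u 0 (n + k) + ∑ j ∈ Finset.range n, q (k + j) * (u (n - 1 - j) 0 + S) := by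
  induction n generalizing k with
  | zero => simp
  | succ n ih =>
    refine (h n k).trans ?_
    rw [Finset.sum_range_succ']
    have e : ∀ j, n + 1 - 1 - (j + 1) = n - 1 - j := fun j => by omega
    simp only [e]
    refine (add_le_add_left (ih (k + 1)) _).trans_eq ?_
    simp only [add_zero, Nat.add_sub_cancel, Nat.sub_zero, add_assoc, add_comm 1]

/-- Strong induction: if all earlier `u m 0` are at most `M`, the unrolled bound is at most `B + θ(M
+ S) ≤ M`. Using `M` once more, but keeping `u 0 T`, gives the second estimate. -/
theorem le_of_recursion {u : ℕ → ℕ → ℝ≥0∞} {q : ℕ → ℝ≥0∞} {S B M θ : ℝ≥0∞} {T : ℕ}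
    (h : ∀ n k, u (n + 1) k ≤ u n (k + 1) + q k * (u n 0 + S))
    (hB : ∀ k, u 0 k ≤ B) (hθ : ∑ j ∈ Finset.range T, q j ≤ θ) (hM : B + θ * (M + S) ≤ M) :
    u T 0 ≤ M ∧ u T 0 ≤ u 0 T + θ * (M + S) := by
  have hsum : ∀ n ≤ T, (∀ m < n, u m 0 ≤ M) →
      u n 0 ≤ u 0 n + θ * (M + S) := by
    intro n hn hm
    refine (le_add_sum_of_recursion h n 0).trans ?_
    rw [add_zero]
    gcongr
    calc ∑ j ∈ Finset.range n, q (0 + j) * (u (n - 1 - j) 0 + S)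
        ≤ ∑ j ∈ Finset.range n, q j * (M + S) := by
          refine Finset.sum_le_sum fun j hj => ?_
          rw [zero_add]
          gcongr
          exact hm _ (by have := Finset.mem_range.1 hj; omega)
      _ = (∑ j ∈ Finset.range n, q j) * (M + S) := by rw [Finset.sum_mul]
      _ ≤ θ * (M + S) := by
          gcongr
          exact (Finset.sum_le_sum_of_subset (Finset.range_mono hn)).trans hθ
  have hall : ∀ n ≤ T, u n 0 ≤ M := by
    intro n
    induction n using Nat.strong_induction_on with
    | _ n ih =>
      intro hn
      refine (hsum n hn fun m hm => ih m hm (by omega)).trans (le_trans ?_ hM)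
      gcongr
      exact hB n
  exact ⟨hall T le_rfl, hsum T le_rfl fun m hm => hall m hm.le⟩

/-! ### Consequences of the step-size condition -/

section StepSize

/-- `H_(T-1) - log T` is below Euler's constant, which is below `2/3 < log 2`. -/
theorem sum_inv_le_log_two_mul {T : ℕ} (hT : 1 ≤ T) :
    ∑ j ∈ Finset.range (T - 1), ((j : ℝ) + 1)⁻¹ ≤ Real.log (2 * T) := by
  have h := (Real.eulerMascheroniSeq_lt_eulerMascheroniConstant (T - 1)).trans
    Real.eulerMascheroniConstant_lt_two_thirds
  have hT' : (0 : ℝ) < T := by exact_mod_cast hT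
  have e : ((T - 1 : ℕ) : ℝ) + 1 = T := by exact_mod_cast Nat.sub_add_cancel hT
  rw [Real.eulerMascheroniSeq, harmonic, e] at h
  push_cast at h
  rw [Real.log_mul two_ne_zero hT'.ne']
  linarith [Real.log_two_gt_d9]

variable {κ γ cγ η : ℝ} {T : ℕ}

theorem rpow_le_two_mul_of_one_le (hγ : 0 ≤ γ) (hη : 0 < η) (hT : 1 ≤ T) :
    η ^ (γ + 1) ≤ 2 * (η ^ (γ + 1) * (T : ℝ) ^ γ * Real.log (2 * T)) := by
  have hT' : (1 : ℝ) ≤ T := by exact_mod_cast hT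
  have h1 : 1 ≤ (T : ℝ) ^ γ := Real.one_le_rpow hT' hγ
  have h2 : 1 / 2 ≤ Real.log (2 * T) := by
    have : Real.log 2 ≤ Real.log (2 * T) := Real.log_le_log two_pos (by linarith)
    linarith [Real.log_two_gt_d9]
  have h3 : 0 < η ^ (γ + 1) := by positivity
  have h4 : 1 / 2 ≤ (T : ℝ) ^ γ * Real.log (2 * T) := by nlinarith
  nlinarith

/-- If `ηκ² > 1`, then `η^(γ+1) ≥ κ⁻⁴` since `κ ≥ 1` and `γ ≤ 1`; but the condition, with `log(2T) ≥
1/2`, forces `η^(γ+1) ≤ κ⁻⁴/2`. -/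
theorem mul_sq_le_one_of_step (hκ : 1 ≤ κ) (hγ : γ ∈ Set.Icc (0 : ℝ) 1) (hcγ : 0 < cγ)
    (hη : 0 < η) (hT : 1 ≤ T)
    (h : η ^ (γ + 1) * (T : ℝ) ^ γ * Real.log (2 * T) ≤ 1 / (4 * κ ^ 2 * (cγ + κ ^ 2))) :
    η * κ ^ 2 ≤ 1 := by
  by_contra! hlt
  have hκ2 : 0 < κ ^ 2 := by positivity
  have h1 : 1 / κ ^ 2 < η := by rw [div_lt_iff₀ hκ2]; exact hlt
  have h2 : (1 / κ ^ 2) ^ (2 : ℝ) ≤ η ^ (γ + 1) := by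
    calc (1 / κ ^ 2) ^ (2 : ℝ) ≤ (1 / κ ^ 2) ^ (γ + 1) :=
          Real.rpow_le_rpow_of_exponent_ge (by positivity)
            (by rw [div_le_one hκ2]; nlinarith) (by linarith [hγ.2])
      _ ≤ η ^ (γ + 1) := Real.rpow_le_rpow (by positivity) h1.le (by linarith [hγ.1])
  have h3 := rpow_le_two_mul_of_one_le (γ := γ) hγ.1 hη hT
  have h4 : 1 / (4 * κ ^ 2 * (cγ + κ ^ 2)) ≤ 1 / (4 * κ ^ 2 * κ ^ 2) := by
    apply one_div_le_one_div_of_le (by positivity); nlinarith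
  have h5 : 1 / (4 * κ ^ 2 * κ ^ 2) = (1 / κ ^ 2) ^ (2 : ℝ) / 4 := by
    rw [Real.rpow_two]; field_simp
  have h6 : 0 < (1 / κ ^ 2) ^ (2 : ℝ) := by positivity
  linarith

/-- The undamped index `j = 0` uses only `‖φ_v‖ ≤ κ` and `η² ≤ η^(γ+1)`. For `j ≥ 1`, `η²(ηj)^(γ-1)
= η^(γ+1) j^γ / j`; bounding `j^γ` by `T^γ` leaves a harmonic sum. -/
theorem sum_variance_le (hκ : 1 ≤ κ) (hγ : γ ∈ Set.Icc (0 : ℝ) 1) (hcγ : 0 < cγ)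
    (hη : 0 < η) (hT : 1 ≤ T) (hηκ : η * κ ^ 2 ≤ 1) :
    ∑ j ∈ Finset.range T, η ^ 2 * κ ^ 2 *
        (if j = 0 then κ ^ 2 else 2 * cγ * (η * j) ^ (γ - 1))
      ≤ 2 * κ ^ 2 * (κ ^ 2 + cγ) * (η ^ (γ + 1) * (T : ℝ) ^ γ * Real.log (2 * T)) := by
  set W := η ^ (γ + 1) * (T : ℝ) ^ γ * Real.log (2 * T) with hW
  obtain ⟨n, rfl⟩ : ∃ n, T = n + 1 := ⟨T - 1, by omega⟩
  have hη1 : η ≤ 1 := (le_mul_of_one_le_right hη.le (one_le_pow₀ hκ)).trans hηκ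
  rw [Finset.sum_range_succ']
  have h0 : η ^ 2 * κ ^ 2 * κ ^ 2 ≤ 2 * κ ^ 2 * κ ^ 2 * W := by
    have h1 : η ^ 2 ≤ η ^ (γ + 1) := by
      rw [← Real.rpow_two]
      exact Real.rpow_le_rpow_of_exponent_ge hη hη1 (by linarith [hγ.2])
    have h2 := h1.trans (rpow_le_two_mul_of_one_le (γ := γ) hγ.1 hη hT)
    calc η ^ 2 * κ ^ 2 * κ ^ 2 ≤ 2 * W * κ ^ 2 * κ ^ 2 := by gcongr
      _ = _ := by ring
  have hs : ∑ j ∈ Finset.range n, η ^ 2 * κ ^ 2 *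
        (if j + 1 = 0 then κ ^ 2 else 2 * cγ * (η * ((j + 1 : ℕ) : ℝ)) ^ (γ - 1))
      ≤ 2 * κ ^ 2 * cγ * W := by
    calc _ ≤ ∑ j ∈ Finset.range n, 2 * κ ^ 2 * cγ * (η ^ (γ + 1) * ((n + 1 : ℕ) : ℝ) ^ γ)
          * ((j : ℝ) + 1)⁻¹ := by
          refine Finset.sum_le_sum fun j hj => ?_
          rw [if_neg (Nat.succ_ne_zero j)]
          have hj' : j < n := Finset.mem_range.1 hj
          have hj1 : (0 : ℝ) < (j : ℝ) + 1 := by positivity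
          have e1 : η ^ 2 * (η * ((j + 1 : ℕ) : ℝ)) ^ (γ - 1)
              = η ^ (γ + 1) * ((j : ℝ) + 1) ^ γ * ((j : ℝ) + 1)⁻¹ := by
            push_cast
            rw [Real.mul_rpow hη.le hj1.le, Real.rpow_sub_one hη.ne', Real.rpow_sub_one hj1.ne',
              Real.rpow_add_one hη.ne']
            field_simp
          calc η ^ 2 * κ ^ 2 * (2 * cγ * (η * ((j + 1 : ℕ) : ℝ)) ^ (γ - 1))
              = 2 * κ ^ 2 * cγ * (η ^ 2 * (η * ((j + 1 : ℕ) : ℝ)) ^ (γ - 1)) := by ring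
            _ = 2 * κ ^ 2 * cγ * (η ^ (γ + 1) * ((j : ℝ) + 1) ^ γ) * ((j : ℝ) + 1)⁻¹ := by
              rw [e1]; ring
            _ ≤ _ := by
              have : ((j : ℝ) + 1) ^ γ ≤ ((n + 1 : ℕ) : ℝ) ^ γ := by
                refine Real.rpow_le_rpow hj1.le ?_ hγ.1
                push_cast
                have : (j : ℝ) ≤ n := by exact_mod_cast hj'.le
                linarith
              gcongr
      _ = 2 * κ ^ 2 * cγ * (η ^ (γ + 1) * ((n + 1 : ℕ) : ℝ) ^ γ)
          * ∑ j ∈ Finset.range n, ((j : ℝ) + 1)⁻¹ := by rw [Finset.mul_sum]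
      _ ≤ 2 * κ ^ 2 * cγ * (η ^ (γ + 1) * ((n + 1 : ℕ) : ℝ) ^ γ)
          * Real.log (2 * ((n + 1 : ℕ) : ℝ)) := by
          gcongr
          exact sum_inv_le_log_two_mul hT
      _ = _ := by rw [hW]; ring
  rw [if_pos rfl]
  nlinarith

end StepSize

/-! ### Bias, variance and the final rate -/

section Convergence

variable {α V : Type*} [MeasurableSpace α] [MeasurableSpace V] {ρ : Measure (α × ℝ)}
  [IsProbabilityMeasure ρ] {μ : Measure V} [IsProbabilityMeasure μ] {φ : V → α → ℝ} {κ : ℝ}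
  {K : α → α → ℝ}

/-- The two bounds on the mean squared error: boundedness, and bias plus variance. -/
theorem dampedError_le [SecondCountableTopology (Lp ℝ 2 ρ.fst)]
    (hφ : Measurable (Function.uncurry φ)) (hκ : 1 ≤ κ)
    (hb : ∀ᵐ v ∂μ, ∀ᵐ x ∂ρ.fst, |φ v x| ≤ κ) (hK : ∀ x x', K x x' = ∫ v, φ v x * φ v x' ∂μ)
    (hK2 : MemLp (Function.uncurry K) 2 (ρ.fst.prod ρ.fst))
    (hy : Integrable (fun p : α × ℝ => p.2 ^ 2) ρ)
    {F : Lp ℝ 2 ρ.fst} (hF : F =ᵐ[ρ.fst] regressionFunction ρ)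
    {γ cγ : ℝ} (hγ : γ ∈ Set.Icc (0 : ℝ) 1) (hcγ : 0 < cγ)
    (heff : ∀ lam : ℝ, 0 < lam →
      effectiveDimension (integralOperator ρ.fst K) lam ≤ ENNReal.ofReal (cγ * lam ^ (-γ)))
    {T : ℕ} (hT : 1 ≤ T) {η : ℝ} (hη : 0 < η)
    (hηT : η ^ (γ + 1) * (T : ℝ) ^ γ * Real.log (2 * T) ≤ 1 / (4 * κ ^ 2 * (cγ + κ ^ 2))) :
    dampedError ρ μ φ K η F T 0
        ≤ ENNReal.ofReal (2 * ‖F‖ ^ 2 + expectedRisk ρ (regressionFunction ρ)) ∧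
      dampedError ρ μ φ K η F T 0
        ≤ ENNReal.ofReal (‖((1 - η • integralOperator ρ.fst K) ^ T) F‖ ^ 2
          + 4 * κ ^ 2 * (κ ^ 2 + cγ) * (η ^ (γ + 1) * (T : ℝ) ^ γ * Real.log (2 * T))
            * (‖F‖ ^ 2 + expectedRisk ρ (regressionFunction ρ))) := by
  have hκ0 : 0 ≤ κ := by linarith
  have hηκ := mul_sq_le_one_of_step hκ hγ hcγ hη hT hηT
  set W := η ^ (γ + 1) * (T : ℝ) ^ γ * Real.log (2 * T) with hW
  set S := expectedRisk ρ (regressionFunction ρ) with hS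
  have hS0 : 0 ≤ S := integral_nonneg fun p => sq_nonneg _
  have hW0 : 0 ≤ W := by
    have := rpow_le_two_mul_of_one_le (γ := γ) hγ.1 hη hT
    have h2 : 0 < η ^ (γ + 1) := by positivity
    linarith
  have hθ : 2 * κ ^ 2 * (κ ^ 2 + cγ) * W ≤ 1 / 2 := by
    rw [le_div_iff₀ (by positivity)] at hηT
    linarith
  have h := le_of_recursion (u := dampedError ρ μ φ K η F)
    (q := fun k => ENNReal.ofReal (η ^ 2 * κ ^ 2) * (∫⁻ v, ENNReal.ofReal
          (‖((1 - η • integralOperator ρ.fst K) ^ k) (featureLp ρ.fst φ v)‖ ^ 2) ∂μ))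
    (S := ENNReal.ofReal S) (B := ENNReal.ofReal (‖F‖ ^ 2))
    -- This `M` is the fixed point of `M ↦ ‖F‖² + (M + S)/2`, the recursion with total noise weight
    -- `1/2`.
    (M := ENNReal.ofReal (2 * ‖F‖ ^ 2 + S))
    (θ := ENNReal.ofReal (2 * κ ^ 2 * (κ ^ 2 + cγ) * W)) (T := T)
    (dampedError_succ_le hφ hκ0 hb hK hK2 hy hF hη hηκ) (fun k => by
      rw [dampedError_zero]
      have := norm_one_sub_pow_apply_le
        ((isPositive_integralOperator hφ hb hK hK2).smul_of_nonneg hη.le)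
        (isPositive_one_sub_integralOperator hφ hκ0 hb hK hK2 hη.le hηκ) k F
      gcongr) (by
      refine le_trans ?_ (ENNReal.ofReal_le_ofReal (sum_variance_le hκ hγ hcγ hη hT hηκ))
      rw [ENNReal.ofReal_sum_of_nonneg fun j _ => by split_ifs <;> positivity]
      refine Finset.sum_le_sum fun j _ => ?_
      rw [ENNReal.ofReal_mul (p := η ^ 2 * κ ^ 2) (by positivity)]
      refine mul_le_mul' le_rfl ?_
      split_ifs with hj
      · subst hj
        simpa only [pow_zero, one_apply_eq_self] using lintegral_norm_featureLp_le hφ hκ0 hb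
      · exact lintegral_norm_damped_featureLp_le hφ hκ0 hb hK hK2 hη hηκ hcγ heff hj) (by
      rw [← ENNReal.ofReal_add (by positivity) hS0, ← ENNReal.ofReal_mul (by positivity),
        ← ENNReal.ofReal_add (by positivity) (by positivity)]
      refine ENNReal.ofReal_le_ofReal ?_
      nlinarith [mul_le_mul_of_nonneg_right hθ
        (by positivity : 0 ≤ 2 * ‖F‖ ^ 2 + S + S)])
  refine ⟨h.1, h.2.trans_eq ?_⟩
  rw [dampedError_zero, ← ENNReal.ofReal_add (by positivity) hS0,
    ← ENNReal.ofReal_mul (by positivity), ← ENNReal.ofReal_add (by positivity) (by positivity)]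
  congr 1; ring

/-- Independence and the common law identify the joint law of the samples with the product measure
on which `dampedError` is defined. -/
theorem lintegral_iterate_eq_dampedError [SecondCountableTopology (Lp ℝ 2 ρ.fst)]
    (hφ : Measurable (Function.uncurry φ))
    (hb : ∀ᵐ v ∂μ, ∀ᵐ x ∂ρ.fst, |φ v x| ≤ κ) {F : Lp ℝ 2 ρ.fst}
    (hF : F =ᵐ[ρ.fst] regressionFunction ρ) (η : ℝ) (T : ℕ) {Ω : Type*} [MeasurableSpace Ω]
    {P : Measure Ω} [IsProbabilityMeasure P] {z : ℕ → Ω → α × ℝ} {v : ℕ → Ω → V}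
    (hlaw : ∀ t ∈ Finset.Icc 1 T, HasLaw (fun ω => (z t ω, v t ω)) (ρ.prod μ) P)
    (hindep : iIndepFun (fun (t : Finset.Icc 1 T) ω => (z t ω, v t ω)) P) :
    ∫⁻ ω, eLpNorm (fun x => iterate φ (fun _ => η) 0 (fun t => z t ω) (fun t => v t ω) (T + 1) x
            - regressionFunction ρ x) 2 ρ.fst ^ 2 ∂P = dampedError ρ μ φ K η F T 0 := by
  have hmem : ∀ i : Fin T, (i : ℕ) + 1 ∈ Finset.Icc 1 T := fun i =>
    Finset.mem_Icc.2 ⟨by omega, by omega⟩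
  have hind : iIndepFun (fun (i : Fin T) ω => (z (i + 1) ω, v (i + 1) ω)) P :=
    hindep.precomp (g := fun i : Fin T => (⟨i + 1, hmem i⟩ : Finset.Icc 1 T)) fun i j hij => by
      simpa [Fin.ext_iff] using hij
  have hae : ∀ i : Fin T, AEMeasurable (fun ω => (z (i + 1) ω, v (i + 1) ω)) P :=
    fun i => (hlaw _ (hmem i)).aemeasurable
  have hmap : P.map (fun ω (i : Fin T) => (z (i + 1) ω, v (i + 1) ω))
      = Measure.pi fun _ : Fin T => ρ.prod μ := by
    rw [(iIndepFun_iff_map_fun_eq_pi_map hae).1 hind]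
    congr 1; ext1 i
    exact (hlaw _ (hmem i)).map_eq
  have haeW : AEMeasurable (fun ω (i : Fin T) => (z (i + 1) ω, v (i + 1) ω)) P :=
    aemeasurable_pi_lambda _ hae
  have hgood := ae_runError_ae_eq hφ hb hF η T
  rw [← hmap] at hgood
  rw [dampedError, ← hmap, lintegral_map' _ haeW]
  · refine lintegral_congr_ae ?_
    filter_upwards [ae_of_ae_map haeW hgood] with ω hω
    rw [iterate_eq_run, ← eLpNorm_congr_ae hω, pow_zero, one_apply_eq_self, Lp.norm_def,
      ENNReal.ofReal_pow ENNReal.toReal_nonneg, ENNReal.ofReal_toReal (Lp.eLpNorm_ne_top _)]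
  · exact ((((1 - η • integralOperator ρ.fst K) ^ 0).continuous.comp_stronglyMeasurable
      (stronglyMeasurable_runError hφ η F T)).norm.pow 2).measurable.ennreal_ofReal.aemeasurable

end Convergence

/-- The combination of the bias and variance bounds into the rate with explicit constant. -/
theorem rate_le {R ζ f S k c η γ b : ℝ} {T : ℕ} (hζ : 0 < ζ) (hS : 0 ≤ S) (hk : 0 < k)
    (hc : 0 < c) (hη : 0 < η) (hη1 : η ≤ 1) (hT : 1 ≤ T) {u : ℝ≥0∞}
    (hb0 : 0 ≤ b) (hb : b ≤ (ζ / (η * T)) ^ ζ * R)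
    (h1 : u ≤ ENNReal.ofReal (2 * f ^ 2 + S))
    (h2 : u ≤ ENNReal.ofReal (b ^ 2
      + 4 * k * (k + c) * (η ^ (γ + 1) * (T : ℝ) ^ γ * Real.log (2 * T)) * (f ^ 2 + S))) :
    u ≤ ENNReal.ofReal ((R ^ 2 * (ζ ^ ζ) ^ 2 + 8 * |k * (k + c)| * (f ^ 2 + |S|)
        + 2 * f ^ 2 + |S| + 1)
      * ((η * T) ^ (-2 * ζ) + η ^ (γ + 1) * (T : ℝ) ^ γ * Real.log T)) := by
  have hT' : (1 : ℝ) ≤ T := by exact_mod_cast hT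
  rw [abs_of_nonneg hS, abs_of_pos (by positivity : 0 < k * (k + c))]
  have hv : 0 ≤ 8 * (k * (k + c)) * (f ^ 2 + S) := by positivity
  have hbias : 0 ≤ R ^ 2 * (ζ ^ ζ) ^ 2 := by positivity
  have hB : 0 ≤ (η * T) ^ (-2 * ζ) := by positivity
  have hlog : 0 ≤ Real.log T := Real.log_nonneg hT'
  have hV : 0 ≤ η ^ (γ + 1) * (T : ℝ) ^ γ * Real.log T := by positivity
  -- At `T = 1` the term with `log T` vanishes, so the uniform bound is used together with `η^(-2ζ)
  -- ≥ 1`. For `T ≥ 2`, `log(2T) ≤ 2 log T` doubles the variance constant from 4 to 8.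
  obtain rfl | hT2 := hT.eq_or_lt
  · refine h1.trans (ENNReal.ofReal_le_ofReal ?_)
    have : 1 ≤ (η * ((1 : ℕ) : ℝ)) ^ (-2 * ζ) :=
      Real.one_le_rpow_of_pos_of_le_one_of_nonpos (by simpa using hη) (by simpa using hη1)
        (by linarith)
    nlinarith [sq_nonneg f]
  · refine h2.trans (ENNReal.ofReal_le_ofReal ?_)
    have hT3 : (2 : ℝ) ≤ T := by exact_mod_cast hT2
    have hl : Real.log (2 * T) ≤ 2 * Real.log T := by
      rw [Real.log_mul two_ne_zero (by positivity)]
      have := Real.log_le_log two_pos hT3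
      linarith
    have e : ((ζ / (η * T)) ^ ζ * R) ^ 2 = R ^ 2 * (ζ ^ ζ) ^ 2 * (η * T) ^ (-2 * ζ) := by
      have e2 : (η * T) ^ (-2 * ζ) = (((η * T) ^ ζ) ^ 2)⁻¹ := by
        rw [← Real.rpow_natCast, ← Real.rpow_mul (by positivity), ← Real.rpow_neg (by positivity)]
        congr 1; push_cast; ring
      rw [Real.div_rpow hζ.le (by positivity), e2]
      field_simp
    have hb2 : b ^ 2 ≤ R ^ 2 * (ζ ^ ζ) ^ 2 * (η * T) ^ (-2 * ζ) := by
      rw [← e]; gcongr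
    have hvar : 4 * k * (k + c) * (η ^ (γ + 1) * (T : ℝ) ^ γ * Real.log (2 * T)) * (f ^ 2 + S)
        ≤ 8 * (k * (k + c)) * (f ^ 2 + S) * (η ^ (γ + 1) * (T : ℝ) ^ γ * Real.log T) := by
      calc _ ≤ 4 * k * (k + c) * (η ^ (γ + 1) * (T : ℝ) ^ γ * (2 * Real.log T)) * (f ^ 2 + S) := by
            gcongr
        _ = _ := by ring
    have r1 : 0 ≤ (2 * f ^ 2 + S + 1) *
        ((η * T) ^ (-2 * ζ) + η ^ (γ + 1) * (T : ℝ) ^ γ * Real.log T) := by positivity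
    have r2 := mul_nonneg hbias hV
    have r3 := mul_nonneg hv hB
    nlinarith

end DoublyStochastic

end

open DoublyStochastic in
theorem mainTheorem1 :
    ∃ C : ℝ → ℝ → ℝ → ℝ → ℝ → ℝ → ℝ, (∀ a₁ a₂ a₃ a₄ a₅ a₆, 0 < C a₁ a₂ a₃ a₄ a₅ a₆) ∧
    ∀ {d : ℕ} {X : Set (EuclideanSpace ℝ (Fin d))} (_hX : IsClosed X)
      -- the data distribution on `X × ℝ`, with finite second moment of the output
      (ρ : Measure (X × ℝ)) [IsProbabilityMeasure ρ]
      (_hy : Integrable (fun p : X × ℝ => p.2 ^ 2) ρ)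
      -- the random features and the kernel they represent
      {V : Type*} [MeasurableSpace V] (μ : Measure V) [IsProbabilityMeasure μ]
      (φ : V → X → ℝ) (_hφ : Measurable (Function.uncurry φ))
      (_hφ2 : MemLp (Function.uncurry φ) 2 (μ.prod ρ.fst))
      (_hφx : ∀ x, MemLp (fun v => φ v x) 2 μ)
      (K : X → X → ℝ) (_hK : ∀ x x', K x x' = ∫ v, φ v x * φ v x' ∂μ)
      -- bounded kernel and bounded features
      (_hKm : Measurable (Function.uncurry K))
      (κ : ℝ) (_hκ : 1 ≤ κ) (_hKb : ∀ᵐ x ∂ρ.fst, K x x ≤ κ ^ 2)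
      (_hφb : ∀ᵐ p ∂(μ.prod (ρ.fst.prod ρ.fst)), φ p.1 p.2.1 * φ p.1 p.2.2 ≤ κ ^ 2)
      -- source condition: `f_ρ = L_K ^ ζ g` with `‖g‖ ≤ R`
      (ζ R : ℝ) (_hζ : 0 < ζ) (_hR : 0 < R)
      (_hsource : ∃ g : Lp ℝ 2 ρ.fst, ‖g‖ ≤ R ∧
        ((opRpow (integralOperator ρ.fst K) ζ g : Lp ℝ 2 ρ.fst) : X → ℝ) =ᵐ[ρ.fst] regressionFunction ρ)
      -- bound on the effective dimension
      (γ cγ : ℝ) (_hγ : γ ∈ Set.Icc (0 : ℝ) 1) (_hcγ : 0 < cγ)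
      (_heff : ∀ lam : ℝ, 0 < lam →
        effectiveDimension (integralOperator ρ.fst K) lam ≤ ENNReal.ofReal (cγ * lam ^ (-γ)))
      -- number of steps and constant step size
      (T : ℕ) (_hT : 1 ≤ T) (η : ℝ) (_hη : 0 < η)
      (_hηT : η ^ (γ + 1) * (T : ℝ) ^ γ * Real.log (2 * T) ≤ 1 / (4 * κ ^ 2 * (cγ + κ ^ 2)))
      -- the i.i.d. sample `(z_t, v_t)`, `t = 1, …, T`, with law `ρ ⊗ μ`
      {Ω : Type*} [MeasurableSpace Ω] (P : Measure Ω) [IsProbabilityMeasure P]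
      (z : ℕ → Ω → X × ℝ) (v : ℕ → Ω → V)
      (_hlaw : ∀ t ∈ Finset.Icc 1 T, HasLaw (fun ω => (z t ω, v t ω)) (ρ.prod μ) P)
      (_hindep : iIndepFun (fun (t : Finset.Icc 1 T) ω => (z t ω, v t ω)) P),
      ∫⁻ ω, eLpNorm (fun x => iterate φ (fun _ => η) 0 (fun t => z t ω) (fun t => v t ω) (T + 1) x
            - regressionFunction ρ x) 2 ρ.fst ^ 2 ∂P
        ≤ ENNReal.ofReal
            (C R ζ (eLpNorm (regressionFunction ρ) 2 ρ.fst).toReal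
                (expectedRisk ρ (regressionFunction ρ)) (κ ^ 2) cγ
              * ((η * T) ^ (-2 * ζ) + η ^ (γ + 1) * (T : ℝ) ^ γ * Real.log T)) := by
  refine ⟨fun R ζ f S k c => R ^ 2 * (ζ ^ ζ) ^ 2 + 8 * |k * (k + c)| * (f ^ 2 + |S|)
    + 2 * f ^ 2 + |S| + 1, fun R ζ f S k c => by positivity, ?_⟩
  intro d X _ ρ _ hy V _ μ _ φ hφ _ hφx K hK hKm κ hκ hKb hφb ζ R hζ hR hsource γ cγ hγ hcγ heff
    T hT η hη hηT Ω _ P _ z v hlaw hindep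
  obtain ⟨g, hg, hF⟩ := hsource
  -- Needed for instance search to find that `L²` over a subset of `ℝ^d` is separable.
  have : Fact ((2 : ℝ≥0∞) ≠ ∞) := ⟨by norm_num⟩
  have hκ0 : 0 ≤ κ := by linarith
  have hb := ae_abs_le_of_ae_mul_le hκ0 hφb
  have hK2 := memLp_of_feature_representation (ν := ρ.fst) hφx hK hKm hKb
  have hηκ := mul_sq_le_one_of_step hκ hγ hcγ hη hT hηT
  have hbias := norm_pow_opRpow_le (isPositive_integralOperator hφ hb hK hK2) hη
    (isPositive_one_sub_integralOperator hφ hκ0 hb hK hK2 hη.le hηκ) hζ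
    (T := T) (by omega) g
  obtain ⟨h1, h2⟩ := dampedError_le hφ hκ hb hK hK2 hy hF hγ hcγ heff hT hη hηT
  rw [lintegral_iterate_eq_dampedError (K := K) hφ hb hF η T hlaw hindep]
  have hnorm : (eLpNorm (regressionFunction ρ) 2 ρ.fst).toReal
      = ‖opRpow (integralOperator ρ.fst K) ζ g‖ := by
    rw [Lp.norm_def, eLpNorm_congr_ae hF]
  rw [hnorm]
  exact rate_le hζ (integral_nonneg fun p => sq_nonneg _) (by positivity) hcγ hη
    ((le_mul_of_one_le_right hη.le (one_le_pow₀ hκ)).trans hηκ) hT (norm_nonneg _) (hbias.trans (by gcongr)) h1 h2
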